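/- Let $R$ be a commutative ring and $I\lhd R$ an ideal generated by a finite or infinite regular sequence $u_1,u_2,\ldots$ (each $u_i$ is a non-zero-divisor on $R/(u_1,\ldots,u_{i-1})$). Let $\mathbf K_*=\Lambda_R(e_i)$, $\mathrm d e_i=u_i$, be the Koszul complex. For $p\ge 0$ let $\mathrm U^{(p)}$ be the free $R$-module on the monomials $\tilde u^m$ of degree $p$ in symbols $\tilde u_i$, and let $\mathbf Q^{(p)}_*=\mathbf K_*\otimes \mathrm U^{(p)}$, with differential $\mathrm d_{\mathbf Q}=\mathrm d\otimes 1$ and augmentation $\tilde u^m\mapsto u^m$ to $I^p/I^{p+1}$ (where $I^0/I=R/I$); this is a free resolution of $I^p/I^{p+1}$ over $R$. The maps $$\partial^{(p+1)}\colon \mathbf Q^{(p)}_n\to \mathbf Q^{(p+1)}_{n-1},\qquad \partial^{(p+1)}(e_{i_1}\cdots e_{i_n}\tilde u^m)=\sum_{k=1}^n(-1)^{k-1}e_{i_1}\cdots \widehat{e_{i_k}}\cdots e_{i_n}\,\tilde u_{i_k}\tilde u^m\quad(i_1<\cdots<i_n)$$ anticommute with the differentials and induce $\partial^{(p+1)}_*\colon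 \mathrm{Tor}^R_n(R/I,I^p/I^{p+1})\to\mathrm{Tor}^R_{n-1}(R/I,I^{p+1}/I^{p+2})$. For $s\ge1$ let $\mathbf K(R;I^s)_*=\mathbf Q^{(0)}_*\oplus\cdots\oplus\mathbf Q^{(s-1)}_*$ with differential $(x_k)_k\mapsto(\partial^{(k)}x_{k-1}+\mathrm d_{\mathbf Q}x_k)_k$ (where $x_{-1}=0$) and augmentation to $R/I^s$ sending $\tilde u^m$ in $\mathbf Q^{(k)}_0$ to $(-1)^ku^m$; this is a free resolution of $R/I^s$ over $R$. Filtering $R/I\otimes\mathbf K(R;I^s)_*$ by the subcomplexes $\bigoplus_{k\ge p}R/I\otimes \mathbf Q^{(k)}_*$ gives a spectral sequence converging to $\mathrm{Tor}^R_*(R/I,R/I^s)$. Let $s\geq 2$. Then the complex of graded $R/I$-modules $$\mathrm{Tor}^R_*(R/I,R/I)\xrightarrow{\partial^{(1)}_*}\mathrm{Tor}^R_*(R/I,I/I^2)\to\cdots\to\mathrm{Tor}^R_*(R/I,I^{s-2}/I^{s-1})\xrightarrow{\partial^{(s-1)}_*}\mathrm{Tor}^R_*(R/I,I^{s-1}/I^s)$$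 is exact at each intermediate term; moreover $\partial^{(1)}_*$ is injective in positive degrees, and each $\partial^{(p)}_*$ is surjective onto degree $0$. Hence the spectral sequence collapses at its second page (all differentials $d_r$ with $r\ge2$ vanish), this page being zero outside column $s-1$ and the part of column $0$ of total degree $0$. It follows that the natural map $\mathrm{Tor}^R_0(R/I,R/I^s)\to R/I\otimes R/I^s\to R/I$ is an isomorphism, and that for $n\geq 1$ the inclusion $I^{s-1}/I^s\subset R/I^s$ induces an isomorphism $$\mathrm{coker}\bigl(\partial^{(s-1)}_*\colon\mathrm{Tor}^R_{n+1}(R/I,I^{s-2}/I^{s-1})\to\mathrm{Tor}^R_n(R/I,I^{s-1}/I^s)\bigr)\;\cong\;\mathrm{Tor}^R_n(R/I,R/I^s).$$ The natural product of $\mathrm{Tor}^R_*(R/I,R/I^s)$, induced by any morphism $P\otimes P\to P$ over the multiplication of $R/I^s$ for a projective resolution $P$ of $R/I^s$, is well defined, and the product of any two elements of positive degree is zero. -/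

import Mathlib

open CategoryTheory MonoidalCategory
open scoped TensorProduct

noncomputable section

set_option linter.unusedSectionVars false

namespace RegularQuotient

universe u

variable {R : Type u} [CommRing R] {ι : Type} [LinearOrder ι]

/-- `u` is a regular sequence `u₁, u₂, …`, finite or infinite: the linearly ordered index set has
finite initial segments (so it is a finite chain or a copy of `ℕ`), and every `uᵢ` is a
non-zero-divisor on `R ⧸ (uⱼ : j < i)`.  The ideal generated by `u` may be all of `R`. -/
structure IsRegularSeq (u : ι → R) : Prop where
  finite_Iio : ∀ i : ι, (Set.Iio i).Finite
  isSMulRegular : ∀ i : ι, IsSMulRegular (R ⧸ Ideal.span (u '' Set.Iio i)) (u i)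

/-- The ideal `I` generated by the sequence. -/
abbrev idl (u : ι → R) : Ideal R := Ideal.span (Set.range u)

/-- The `R`-module `I ^ p / I ^ (p + 1)` (for `p = 0` this is `R / I`). -/
abbrev Gr (u : ι → R) (p : ℕ) : Type u :=
  ↥(idl u ^ p) ⧸ Submodule.submoduleOf (idl u ^ (p + 1)) (idl u ^ p)

/-! ### The complexes `Q^(p) = K ⊗ U^(p)` -/

/-- Index set of the standard basis of `K_n ⊗ U^(p)`: a basis element is `e_S ũ^m`, where
`e_S = e_{i₁} ⋯ e_{iₙ}` for a set `S = {i₁ < ⋯ < iₙ}` of indices, and `ũ^m` is a monomial of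
degree `p`. -/
abbrev QIdx (ι : Type) (p n : ℕ) : Type :=
  {b : Finset ι × (ι →₀ ℕ) // b.1.card = n ∧ b.2.degree = p}

variable (R ι) in
/-- The free `R`-module `Q^(p)_n = K_n ⊗ U^(p)`, where `K` is the exterior algebra on the `e_i`
and `U^(p)` is free on the monomials of degree `p`. -/
abbrev Q (p n : ℕ) : Type u := QIdx ι p n →₀ R

variable (R) in
/-- The basis element `e_S ũ^m` of `Q^(p)_n` (and `0` if the degrees of `S`, `m` do not match). -/
def bas (p n : ℕ) (S : Finset ι) (m : ι →₀ ℕ) : Q R ι p n :=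
  if h : S.card = n ∧ m.degree = p then Finsupp.single ⟨(S, m), h⟩ 1 else 0

variable (R) in
/-- The sign `(-1)^(k-1)` of the `k`-th smallest element `i` of `S`. -/
def sgn (i : ι) (S : Finset ι) : R := (-1) ^ (S.filter (· < i)).card

/-- The differential of `Q^(p)`, with
`d (e_{i₁} ⋯ e_{iₙ} ũ^m) = ∑ₖ (-1)^(k-1) u_{iₖ} e_{i₁} ⋯ ê_{iₖ} ⋯ e_{iₙ} ũ^m`. -/
def dQ (u : ι → R) (p n : ℕ) : Q R ι p (n + 1) →ₗ[R] Q R ι p n :=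
  Finsupp.linearCombination R fun b : QIdx ι p (n + 1) =>
    ∑ i ∈ b.1.1, (sgn R i b.1.1 * u i) • bas R p n (b.1.1.erase i) b.1.2

variable (R ι) in
/-- The map `∂^(p+1) : Q^(p) → Q^(p+1)` of degree `-1`, with
`∂ (e_{i₁} ⋯ e_{iₙ} ũ^m) = ∑ₖ (-1)^(k-1) e_{i₁} ⋯ ê_{iₖ} ⋯ e_{iₙ} ũ_{iₖ} ũ^m`. -/
def del (p n : ℕ) : Q R ι p (n + 1) →ₗ[R] Q R ι (p + 1) n :=
  Finsupp.linearCombination R fun b : QIdx ι p (n + 1) =>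
    ∑ i ∈ b.1.1, sgn R i b.1.1 • bas R (p + 1) n (b.1.1.erase i) (b.1.2 + Finsupp.single i 1)

theorem sgn_swap {i j : ι} {S : Finset ι} (hi : i ∈ S) (hj : j ∈ S) (hij : i ≠ j) :
    sgn R i S * sgn R j (S.erase i) = -(sgn R j S * sgn R i (S.erase j)) := by
  wlog h : i < j generalizing i j
  · rw [this hj hi hij.symm (lt_of_le_of_ne (not_lt.mp h) hij.symm), neg_neg]
  have h1 : (S.erase j).filter (· < i) = S.filter (· < i) := by
    ext x
    simp only [Finset.mem_filter, Finset.mem_erase]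
    constructor
    · rintro ⟨⟨_, h2⟩, h3⟩; exact ⟨h2, h3⟩
    · rintro ⟨h2, h3⟩; exact ⟨⟨(h3.trans h).ne, h2⟩, h3⟩
  have h2 : (S.erase i).filter (· < j) = (S.filter (· < j)).erase i := by
    rw [Finset.filter_erase]
  have h3 : i ∈ S.filter (· < j) := Finset.mem_filter.mpr ⟨hi, h⟩
  have h4 := Finset.card_erase_add_one h3
  simp only [sgn, h1, h2]
  rw [← h4]
  ring

/-- A sum over ordered pairs of distinct elements of `S`, symmetric up to the signs, vanishes. -/
theorem sum_sgn_eq_zero {M : Type*} [AddCommGroup M] [Module R M] (S : Finset ι)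
    (G : ι → ι → M) (hG : ∀ i j, G i j = G j i) :
    ∑ i ∈ S, ∑ j ∈ S.erase i, (sgn R i S * sgn R j (S.erase i)) • G i j = 0 := by
  rw [Finset.sum_sigma' S (fun i => S.erase i)
    (fun i j => (sgn R i S * sgn R j (S.erase i)) • G i j)]
  refine Finset.sum_involution (fun x _ => ⟨x.2, x.1⟩) ?_ ?_ ?_ ?_
  · rintro ⟨i, j⟩ h
    simp only [Finset.mem_sigma, Finset.mem_erase] at h
    obtain ⟨hi, hji, hj⟩ := h
    simp only
    rw [sgn_swap hi hj (Ne.symm hji), hG i j, neg_smul, neg_add_cancel]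
  · rintro ⟨i, j⟩ h _ he
    simp only [Finset.mem_sigma, Finset.mem_erase] at h
    simp only [Sigma.mk.injEq] at he
    exact h.2.1 he.1
  · rintro ⟨i, j⟩ h
    simp only [Finset.mem_sigma, Finset.mem_erase] at h ⊢
    exact ⟨h.2.2, Ne.symm h.2.1, h.1⟩
  · rintro ⟨i, j⟩ _
    rfl

theorem dQ_bas (u : ι → R) (p n : ℕ) (S : Finset ι) (m : ι →₀ ℕ) (hS : S.card = n + 1) :
    dQ u p n (bas R p (n + 1) S m) =
      ∑ i ∈ S, (sgn R i S * u i) • bas R p n (S.erase i) m := by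
  by_cases hm : m.degree = p
  · simp [dQ, bas, hS, hm]
  · simp [bas, hm]

theorem del_bas (p n : ℕ) (S : Finset ι) (m : ι →₀ ℕ) (hS : S.card = n + 1) :
    del R ι p n (bas R p (n + 1) S m) =
      ∑ i ∈ S, sgn R i S • bas R (p + 1) n (S.erase i) (m + Finsupp.single i 1) := by
  by_cases hm : m.degree = p
  · simp [del, bas, hS, hm]
  · simp [bas, hm]

theorem single_eq_bas (p n : ℕ) (b : QIdx ι p n) :
    Finsupp.single b 1 = bas R p n b.1.1 b.1.2 := by
  simp [bas, b.2.1, b.2.2]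

theorem Q_hom_ext {M : Type*} [AddCommGroup M] [Module R M] {p n : ℕ} {f g : Q R ι p n →ₗ[R] M}
    (h : ∀ S m, S.card = n → m.degree = p → f (bas R p n S m) = g (bas R p n S m)) : f = g := by
  refine Finsupp.lhom_ext' fun b => LinearMap.ext_ring ?_
  simp only [LinearMap.comp_apply, Finsupp.lsingle_apply, single_eq_bas]
  exact h _ _ b.2.1 b.2.2

theorem card_erase' {n : ℕ} {S : Finset ι} (hS : S.card = n + 1) {i : ι} (hi : i ∈ S) :
    (S.erase i).card = n := by
  rw [Finset.card_erase_of_mem hi, hS, Nat.add_sub_cancel]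

theorem dQ_dQ (u : ι → R) (p n : ℕ) : dQ u p n ∘ₗ dQ u p (n + 1) = 0 := by
  refine Q_hom_ext fun S m hS _ => ?_
  rw [LinearMap.comp_apply, dQ_bas u p (n + 1) S m hS, map_sum]
  rw [LinearMap.zero_apply,
    ← sum_sgn_eq_zero (R := R) S (fun i j => (u i * u j) • bas R p n ((S.erase i).erase j) m)
      (fun i j => by simp only [mul_comm (u i), Finset.erase_right_comm])]
  refine Finset.sum_congr rfl fun i hi => ?_
  rw [map_smul, dQ_bas u p n _ m (card_erase' hS hi), Finset.smul_sum]
  refine Finset.sum_congr rfl fun j _ => ?_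
  rw [smul_smul, smul_smul]
  congr 1
  ring

theorem del_del (p n : ℕ) : del R ι (p + 1) n ∘ₗ del R ι p (n + 1) = 0 := by
  refine Q_hom_ext fun S m hS _ => ?_
  rw [LinearMap.comp_apply, del_bas p (n + 1) S m hS, map_sum]
  rw [LinearMap.zero_apply,
    ← sum_sgn_eq_zero (R := R) S (fun i j => bas R (p + 1 + 1) n ((S.erase i).erase j)
        (m + Finsupp.single i 1 + Finsupp.single j 1))
      (fun i j => by
        simp only [Finset.erase_right_comm (a := i)]
        exact congrArg _ (add_right_comm _ _ _))]
  refine Finset.sum_congr rfl fun i hi => ?_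
  rw [map_smul, del_bas (p + 1) n _ _ (card_erase' hS hi), Finset.smul_sum]
  refine Finset.sum_congr rfl fun j _ => ?_
  rw [smul_smul]

theorem dQ_del (u : ι → R) (p n : ℕ) :
    dQ u (p + 1) n ∘ₗ del R ι p (n + 1) + del R ι p n ∘ₗ dQ u p (n + 1) = 0 := by
  refine Q_hom_ext fun S m hS _ => ?_
  rw [LinearMap.add_apply, LinearMap.comp_apply, LinearMap.comp_apply, del_bas p (n + 1) S m hS,
    dQ_bas u p (n + 1) S m hS, map_sum, map_sum, ← Finset.sum_add_distrib]
  rw [LinearMap.zero_apply,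
    ← sum_sgn_eq_zero (R := R) S (fun i j =>
        u j • bas R (p + 1) n ((S.erase i).erase j) (m + Finsupp.single i 1) +
        u i • bas R (p + 1) n ((S.erase i).erase j) (m + Finsupp.single j 1))
      (fun i j => by
        simp only [Finset.erase_right_comm (a := i)]
        exact add_comm _ _)]
  refine Finset.sum_congr rfl fun i hi => ?_
  rw [map_smul, map_smul, dQ_bas u (p + 1) n _ _ (card_erase' hS hi),
    del_bas p n _ _ (card_erase' hS hi), Finset.smul_sum, Finset.smul_sum,
    ← Finset.sum_add_distrib]
  refine Finset.sum_congr rfl fun j _ => ?_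
  rw [smul_add, smul_smul, smul_smul, smul_smul, smul_smul]
  congr 2 <;> ring

theorem QComplex_sq (u : ι → R) (p n : ℕ) :
    ModuleCat.ofHom (dQ u p (n + 1)) ≫ ModuleCat.ofHom (dQ u p n) = 0 := by
  rw [← ModuleCat.ofHom_comp, dQ_dQ]
  rfl

/-- The chain complex `Q^(p)`. -/
def QComplex (u : ι → R) (p : ℕ) : ChainComplex (ModuleCat.{u} R) ℕ :=
  ChainComplex.of (fun n => ModuleCat.of R (Q R ι p n)) (fun n => ModuleCat.ofHom (dQ u p n))
    (QComplex_sq u p)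

theorem QComplex_d (u : ι → R) (p n : ℕ) :
    (QComplex u p).d (n + 1) n = ModuleCat.ofHom (dQ u p n) :=
  ChainComplex.of_d (fun n => ModuleCat.of R (Q R ι p n)) (fun n => ModuleCat.ofHom (dQ u p n)) n

/-- The element `u^m = ∏ uᵢ ^ mᵢ`. -/
def mon (u : ι → R) (m : ι →₀ ℕ) : R := m.prod fun i k => u i ^ k

theorem mon_mem (u : ι → R) (m : ι →₀ ℕ) : mon u m ∈ idl u ^ m.degree := by
  rw [mon, Finsupp.prod, Finsupp.degree_apply, ← Finset.prod_pow_eq_pow_sum]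
  exact Ideal.prod_mem_prod fun i _ =>
    Ideal.pow_mem_pow (Ideal.subset_span (Set.mem_range_self i)) _

theorem mon_mem' (u : ι → R) {m : ι →₀ ℕ} {p : ℕ} (h : m.degree = p) : mon u m ∈ idl u ^ p := by
  rw [← h]
  exact mon_mem u m

theorem mon_add_single (u : ι → R) (m : ι →₀ ℕ) (i : ι) :
    mon u (m + Finsupp.single i 1) = mon u m * u i := by
  rw [mon, Finsupp.prod_add_index' (by simp) (by simp [pow_add])]
  simp [mon]

/-- The augmentation `Q^(p)_0 → I^p / I^(p+1)`, sending `ũ^m` to the class of `u^m`. -/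
def augQ (u : ι → R) (p : ℕ) : Q R ι p 0 →ₗ[R] Gr u p :=
  Finsupp.linearCombination R fun b : QIdx ι p 0 =>
    Submodule.Quotient.mk ⟨mon u b.1.2, mon_mem' u b.2.2⟩

theorem augQ_dQ (u : ι → R) (p : ℕ) : augQ u p ∘ₗ dQ u p 0 = 0 := by
  refine Q_hom_ext fun S m hS hm => ?_
  rw [LinearMap.comp_apply, dQ_bas u p 0 S m hS, map_sum, LinearMap.zero_apply]
  refine Finset.sum_eq_zero fun i hi => ?_
  rw [map_smul, mul_smul]
  have h : u i • augQ u p (bas R p 0 (S.erase i) m) = 0 := by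
    simp only [augQ, bas, card_erase' hS hi, hm, true_and, dite_true,
      Finsupp.linearCombination_single, one_smul]
    rw [← Submodule.Quotient.mk_smul, Submodule.Quotient.mk_eq_zero, Submodule.submoduleOf,
      Submodule.mem_comap]
    change u i * mon u m ∈ _
    rw [pow_succ']
    exact Ideal.mul_mem_mul (Ideal.subset_span (Set.mem_range_self i)) (mon_mem' u hm)
  rw [h, smul_zero]

/-- The augmentation `Q^(p) → I^p / I^(p+1)` as a map of complexes. -/
def QAug (u : ι → R) (p : ℕ) :
    QComplex u p ⟶ (ChainComplex.single₀ (ModuleCat.{u} R)).obj (ModuleCat.of R (Gr u p)) :=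
  (ChainComplex.toSingle₀Equiv _ _).symm ⟨ModuleCat.ofHom (augQ u p), by
    rw [QComplex_d u p 0]
    change ModuleCat.ofHom (augQ u p ∘ₗ dQ u p 0) = 0
    rw [augQ_dQ]
    rfl⟩

/-! ### The complex `K(R; I^s)` -/

variable (R ι) in
/-- The free `R`-module `K(R; I^s)_n = Q^(0)_n ⊕ ⋯ ⊕ Q^(s-1)_n`. -/
abbrev K (s n : ℕ) : Type u := ∀ k : Fin s, Q R ι k n

variable (R ι) in
/-- The component `x_k` of an element `(x_0, …, x_(s-1))`. -/
abbrev comp (s n k : ℕ) (hk : k < s) : K R ι s n →ₗ[R] Q R ι k n :=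
  LinearMap.proj (φ := fun k : Fin s => Q R ι k n) ⟨k, hk⟩

/-- The component `x'_k` of `d (x_0, …, x_(s-1)) = (x'_0, …, x'_(s-1))`: it is `d_Q x_0` for
`k = 0` and `∂ x_(k-1) + d_Q x_k` otherwise. -/
def dKcomp (u : ι → R) (s n : ℕ) : (k : ℕ) → k < s → (K R ι s (n + 1) →ₗ[R] Q R ι k n)
  | 0, h => dQ u 0 n ∘ₗ comp R ι s (n + 1) 0 h
  | k + 1, h => del R ι k n ∘ₗ comp R ι s (n + 1) k (Nat.lt_of_succ_lt h) +
      dQ u (k + 1) n ∘ₗ comp R ι s (n + 1) (k + 1) h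

/-- The differential of `K(R; I^s)`. -/
def dK (u : ι → R) (s n : ℕ) : K R ι s (n + 1) →ₗ[R] K R ι s n :=
  LinearMap.pi fun k => dKcomp u s n k k.2

theorem comp_dK (u : ι → R) (s n k : ℕ) (hk : k < s) (x : K R ι s (n + 1)) :
    comp R ι s n k hk (dK u s n x) = dKcomp u s n k hk x := rfl

theorem dK_dK (u : ι → R) (s n : ℕ) : dK u s n ∘ₗ dK u s (n + 1) = 0 := by
  have h1 := fun p x => LinearMap.congr_fun (dQ_dQ u p n) x
  have h2 := fun p x => LinearMap.congr_fun (del_del (R := R) (ι := ι) p n) x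
  have h3 := fun p x => LinearMap.congr_fun (dQ_del u p n) x
  simp only [LinearMap.comp_apply, LinearMap.zero_apply, LinearMap.add_apply] at h1 h2 h3
  refine LinearMap.ext fun x => funext fun ⟨k, hk⟩ => ?_
  change dKcomp u s n k hk (dK u s (n + 1) x) = 0
  match k, hk with
  | 0, hk =>
    simp only [dKcomp, LinearMap.comp_apply, comp_dK, h1]
  | 1, hk =>
    simp only [dKcomp, LinearMap.comp_apply, comp_dK, LinearMap.add_apply, map_add, h1]
    rw [add_zero, add_comm]
    exact h3 0 _
  | k + 2, hk =>
    simp only [dKcomp, LinearMap.comp_apply, comp_dK, LinearMap.add_apply, map_add, h1, h2]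
    rw [add_zero, zero_add]
    exact (add_comm _ _).trans (h3 (k + 1) _)

theorem KComplex_sq (u : ι → R) (s n : ℕ) :
    ModuleCat.ofHom (dK u s (n + 1)) ≫ ModuleCat.ofHom (dK u s n) = 0 := by
  rw [← ModuleCat.ofHom_comp, dK_dK]
  rfl

/-- The chain complex `K(R; I^s)`. -/
def KComplex (u : ι → R) (s : ℕ) : ChainComplex (ModuleCat.{u} R) ℕ :=
  ChainComplex.of (fun n => ModuleCat.of R (K R ι s n)) (fun n => ModuleCat.ofHom (dK u s n))
    (KComplex_sq u s)

theorem KComplex_d (u : ι → R) (s n : ℕ) :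
    (KComplex u s).d (n + 1) n = ModuleCat.ofHom (dK u s n) :=
  ChainComplex.of_d (fun n => ModuleCat.of R (K R ι s n)) (fun n => ModuleCat.ofHom (dK u s n)) n

/-- The map `Q^(p)_0 → R`, `ũ^m ↦ u^m`. -/
def evQ (u : ι → R) (p : ℕ) : Q R ι p 0 →ₗ[R] R :=
  Finsupp.linearCombination R fun b : QIdx ι p 0 => mon u b.1.2

theorem evQ_bas (u : ι → R) (p : ℕ) (S : Finset ι) (m : ι →₀ ℕ) (hS : S.card = 0)
    (hm : m.degree = p) : evQ u p (bas R p 0 S m) = mon u m := by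
  simp [evQ, bas, hS, hm]

theorem evQ_del (u : ι → R) (p : ℕ) (x : Q R ι p 1) :
    evQ u (p + 1) (del R ι p 0 x) = evQ u p (dQ u p 0 x) := by
  refine LinearMap.congr_fun (f := evQ u (p + 1) ∘ₗ del R ι p 0) (g := evQ u p ∘ₗ dQ u p 0)
    (Q_hom_ext fun S m hS hm => ?_) x
  rw [LinearMap.comp_apply, LinearMap.comp_apply, del_bas p 0 S m hS, dQ_bas u p 0 S m hS,
    map_sum, map_sum]
  refine Finset.sum_congr rfl fun i hi => ?_
  rw [map_smul, map_smul, evQ_bas u _ _ _ (card_erase' hS hi) (by simp [hm]),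
    evQ_bas u _ _ _ (card_erase' hS hi) hm, mon_add_single, smul_eq_mul, smul_eq_mul]
  ring

theorem evQ_dQ_mem (u : ι → R) (p : ℕ) (x : Q R ι p 1) :
    evQ u p (dQ u p 0 x) ∈ idl u ^ (p + 1) := by
  rw [← evQ_del]
  rw [evQ, Finsupp.linearCombination_apply]
  exact Submodule.sum_mem _ fun b _ => Ideal.mul_mem_left _ _ (mon_mem' u b.2.2)

/-- The augmentation `K(R; I^s)_0 → R / I^s`, sending the basis element `ũ^m` of `Q^(k)_0` to the
class of `(-1)^k u^m`.  The sign makes it vanish on boundaries. -/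
def augK (u : ι → R) (s : ℕ) : K R ι s 0 →ₗ[R] R ⧸ idl u ^ s :=
  ∑ k : Fin s, (-1 : R) ^ (k : ℕ) •
    (Submodule.mkQ (idl u ^ s) ∘ₗ evQ u k ∘ₗ comp R ι s 0 k k.2)

theorem augK_dK (u : ι → R) (s : ℕ) : augK u s ∘ₗ dK u s 0 = 0 := by
  refine LinearMap.ext fun x => ?_
  -- `a k = ε (d_Q x_k)`, extended by zero
  let a : ℕ → R := fun k => if h : k < s then evQ u k (dQ u k 0 (comp R ι s 1 k h x)) else 0
  have ha : ∀ k (h : k < s), evQ u k (dKcomp u s 0 k h x) =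
      a k + if k = 0 then 0 else a (k - 1) := by
    intro k h
    match k, h with
    | 0, h => simp [a, dKcomp, h]
    | k + 1, h =>
      simp only [a, dKcomp, LinearMap.add_apply, LinearMap.comp_apply, map_add, evQ_del, h,
        Nat.lt_of_succ_lt h, dite_true, Nat.add_sub_cancel, Nat.add_eq_zero_iff, one_ne_zero,
        and_false, if_false]
      rw [add_comm]
  have hs : ∀ t, t ≤ s → ∑ k ∈ Finset.range t,
      (-1 : R) ^ k * (a k + if k = 0 then 0 else a (k - 1)) =
      if t = 0 then 0 else (-1) ^ (t - 1) * a (t - 1) := by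
    intro t
    induction t with
    | zero => simp
    | succ t ih =>
      intro ht
      rw [Finset.sum_range_succ, ih (Nat.le_of_succ_le ht)]
      rcases t with _ | t
      · simp
      · simp [pow_succ]
        ring
  have key : augK u s (dK u s 0 x) = Submodule.mkQ (idl u ^ s) (∑ k ∈ Finset.range s,
      (-1 : R) ^ k * (a k + if k = 0 then 0 else a (k - 1))) := by
    rw [Finset.sum_range, map_sum, augK, LinearMap.sum_apply]
    refine Finset.sum_congr rfl fun k _ => ?_
    rw [← ha k k.2, ← smul_eq_mul, map_smul]
    rfl
  rw [LinearMap.comp_apply, key, hs s le_rfl, LinearMap.zero_apply]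
  rcases s with _ | s
  · simp
  · rw [if_neg (Nat.succ_ne_zero s), Submodule.mkQ_apply, Submodule.Quotient.mk_eq_zero]
    refine Ideal.mul_mem_left _ _ ?_
    simp only [a, Nat.add_sub_cancel, Nat.lt_succ_self, dite_true]
    exact evQ_dQ_mem u s _

/-- The augmentation `K(R; I^s) → R / I^s` as a map of complexes. -/
def KAug (u : ι → R) (s : ℕ) :
    KComplex u s ⟶ (ChainComplex.single₀ (ModuleCat.{u} R)).obj (ModuleCat.of R (R ⧸ idl u ^ s)) :=
  (ChainComplex.toSingle₀Equiv _ _).symm ⟨ModuleCat.ofHom (augK u s), by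
    rw [KComplex_d u s 0]
    change ModuleCat.ofHom (augK u s ∘ₗ dK u s 0) = 0
    rw [augK_dK]
    rfl⟩

/-! ### Tor groups and the maps `∂_*` between them -/

/-- The functor `A ⊗_R (-)`. -/
abbrev tens (R A : Type u) [CommRing R] [AddCommGroup A] [Module R A] :
    ModuleCat.{u} R ⥤ ModuleCat.{u} R :=
  (tensoringLeft (ModuleCat.{u} R)).obj (ModuleCat.of R A)

/-- The complex `A ⊗_R C`. -/
abbrev tensC {R : Type u} (A : Type u) [CommRing R] [AddCommGroup A] [Module R A]
    (C : ChainComplex (ModuleCat.{u} R) ℕ) : ChainComplex (ModuleCat.{u} R) ℕ :=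
  ((tens R A).mapHomologicalComplex _).obj C

/-- `Tor_n^R(A, B)`. -/
abbrev TorM (R A B : Type u) [CommRing R] [AddCommGroup A] [Module R A] [AddCommGroup B]
    [Module R B] (n : ℕ) : ModuleCat.{u} R :=
  ((Tor (ModuleCat.{u} R) n).obj (ModuleCat.of R A)).obj (ModuleCat.of R B)

/-- The map `Tor_n^R(A, B) → Tor_n^R(A, B')` induced by a linear map `B → B'`. -/
abbrev TorMap {R : Type u} (A : Type u) {B B' : Type u} [CommRing R] [AddCommGroup A] [Module R A]
    [AddCommGroup B] [Module R B] [AddCommGroup B'] [Module R B'] (f : B →ₗ[R] B') (n : ℕ) :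
    TorM R A B n ⟶ TorM R A B' n :=
  ((Tor (ModuleCat.{u} R) n).obj (ModuleCat.of R A)).map (ModuleCat.ofHom f)

/-- The comparison of `Tor_n^R(A, B)` with the homology of `A ⊗ P`, for any projective resolution
`P` of `B`. -/
abbrev torIso {R : Type u} (A : Type u) {B : Type u} [CommRing R] [AddCommGroup A] [Module R A]
    [AddCommGroup B] [Module R B] (P : ProjectiveResolution (ModuleCat.of R B)) (n : ℕ) :
    TorM R A B n ≅ (tensC A P.complex).homology n :=
  P.isoLeftDerivedObj (tens R A) n

/-- If `f : C → D` has degree `-1` and anticommutes with the differentials, this is the map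
`[x] ↦ [f x]` which it induces in homology. -/
def degHom {C D : ChainComplex (ModuleCat.{u} R) ℕ} (f : ∀ n, C.X (n + 1) ⟶ D.X n)
    (hf : ∀ n, f (n + 1) ≫ D.d (n + 1) n = -(C.d (n + 2) (n + 1) ≫ f n)) (n : ℕ) :
    C.homology (n + 1) ⟶ D.homology n :=
  (C.homologyIsCokernel (n + 2) (n + 1) (by simp)).desc
    (Limits.CokernelCofork.ofπ
      (D.liftCycles (C.iCycles (n + 1) ≫ f n) (n - 1) (by cases n <;> simp) (by
        cases n with
        | zero => rw [D.shape _ _ (by simp), Limits.comp_zero]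
        | succ n =>
          change (C.iCycles (n + 2) ≫ f (n + 1)) ≫ D.d (n + 1) n = 0
          rw [Category.assoc, hf, Preadditive.comp_neg, ← Category.assoc, C.iCycles_d,
            Limits.zero_comp, neg_zero]) ≫ D.homologyπ n)
      (by
        have h : C.toCycles (n + 2) (n + 1) ≫ D.liftCycles (C.iCycles (n + 1) ≫ f n) (n - 1)
            (by cases n <;> simp) (by
              cases n with
              | zero => rw [D.shape _ _ (by simp), Limits.comp_zero]
              | succ n =>
                change (C.iCycles (n + 2) ≫ f (n + 1)) ≫ D.d (n + 1) n = 0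
                rw [Category.assoc, hf, Preadditive.comp_neg, ← Category.assoc, C.iCycles_d,
                  Limits.zero_comp, neg_zero]) =
            -(f (n + 1) ≫ D.toCycles (n + 1) n) := by
          rw [← cancel_mono (D.iCycles n)]
          simp [hf]
        rw [← Category.assoc, h]
        simp))

/-- The complex `Q^(p)`, as a projective resolution of `I^p / I^(p+1)`. -/
def QRes (u : ι → R) (p : ℕ) (h : QuasiIso (QAug u p)) :
    ProjectiveResolution (ModuleCat.of R (Gr u p)) where
  complex := QComplex u p
  projective n := inferInstanceAs (Projective (ModuleCat.of R (Q R ι p n)))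
  π := QAug u p
  quasiIso := h

/-- The map `∂^(p+1) : Q^(p)_{n+1} → Q^(p+1)_n` as a morphism between terms of the complexes. -/
def delHom (u : ι → R) (p n : ℕ) : (QComplex u p).X (n + 1) ⟶ (QComplex u (p + 1)).X n :=
  ModuleCat.ofHom (del R ι p n)

theorem delHom_comm (u : ι → R) (p n : ℕ) :
    delHom u p (n + 1) ≫ (QComplex u (p + 1)).d (n + 1) n =
      -((QComplex u p).d (n + 2) (n + 1) ≫ delHom u p n) := by
  rw [QComplex_d, QComplex_d u p (n + 1)]
  exact ModuleCat.hom_ext (eq_neg_of_add_eq_zero_left (dQ_del u p n))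

theorem tens_delHom_comm (A : Type u) [AddCommGroup A] [Module R A] (u : ι → R) (p n : ℕ) :
    (tens R A).map (delHom u p (n + 1)) ≫ (tens R A).map ((QComplex u (p + 1)).d (n + 1) n) =
      -((tens R A).map ((QComplex u p).d (n + 2) (n + 1)) ≫ (tens R A).map (delHom u p n)) := by
  rw [← Functor.map_comp, ← Functor.map_comp, ← Functor.map_neg, delHom_comm]

/-- The map `∂^(p+1)_* : Tor_{n+1}^R(R/I, I^p/I^(p+1)) → Tor_n^R(R/I, I^(p+1)/I^(p+2))` induced by
`∂^(p+1) : Q^(p) → Q^(p+1)`, where the complexes `Q^(p)` are known to be resolutions. -/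
def delStar (u : ι → R) (h : ∀ p, QuasiIso (QAug u p)) (p n : ℕ) :
    TorM R (R ⧸ idl u) (Gr u p) (n + 1) ⟶ TorM R (R ⧸ idl u) (Gr u (p + 1)) n :=
  (torIso (R ⧸ idl u) (QRes u p (h p)) (n + 1)).hom ≫
    degHom (C := tensC (R ⧸ idl u) (QComplex u p)) (D := tensC (R ⧸ idl u) (QComplex u (p + 1)))
      (fun n => (tens R (R ⧸ idl u)).map (delHom u p n))
      (tens_delHom_comm (R ⧸ idl u) u p) n ≫
    (torIso (R ⧸ idl u) (QRes u (p + 1) (h (p + 1))) n).inv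

/-- The inclusion `I^p / I^(p+1) → R / I^(p+1)`. -/
def grIncl (u : ι → R) (p : ℕ) : Gr u p →ₗ[R] R ⧸ idl u ^ (p + 1) :=
  Submodule.mapQ (Submodule.submoduleOf (idl u ^ (p + 1)) (idl u ^ p)) (idl u ^ (p + 1))
    (Submodule.subtype (idl u ^ p)) le_rfl

/-- The map `Tor_0^R(R/I, R/I^s) → R/I ⊗ R/I^s → R/I` (the second map is `a ⊗ b ↦ a b`), for
`s ≥ 1`. -/
def torZeroMap (u : ι → R) (s : ℕ) (hs : s ≠ 0) :
    TorM R (R ⧸ idl u) (R ⧸ idl u ^ s) 0 →ₗ[R] R ⧸ idl u :=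
  (LinearMap.mul' R (R ⧸ idl u) ∘ₗ
    LinearMap.lTensor (R ⧸ idl u) (Submodule.factor (Ideal.pow_le_self hs))) ∘ₗ
  ((tens R (R ⧸ idl u)).fromLeftDerivedZero.app (ModuleCat.of R (R ⧸ idl u ^ s))).hom

/-! ### The spectral sequence of a filtered complex

`F p n` is the `p`-th step of a decreasing filtration of `C_n`.  The term `page C F r p n` is the
part of the `r`-th page in filtration degree `p` and total degree `n`. -/

section SpectralSequence

variable (C : ChainComplex (ModuleCat.{u} R) ℕ) (F : ℤ → ∀ n, Submodule R (C.X n))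

/-- `Z_r^p = {x ∈ F^p | d x ∈ F^(p+r)}`. -/
def cyc (r p : ℤ) (n : ℕ) : Submodule R (C.X n) :=
  F p n ⊓ (F (p + r) (n - 1)).comap (C.d n (n - 1)).hom

/-- `Z_(r-1)^(p+1) + d Z_(r-1)^(p-r+1)`. -/
def bdry (r p : ℤ) (n : ℕ) : Submodule R (C.X n) :=
  cyc C F (r - 1) (p + 1) n ⊔ (cyc C F (r - 1) (p - r + 1) (n + 1)).map (C.d (n + 1) n).hom

/-- `E_r^p = Z_r^p / (Z_(r-1)^(p+1) + d Z_(r-1)^(p-r+1))`. -/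
abbrev page (r p : ℤ) (n : ℕ) : Type u :=
  ↥(cyc C F r p n) ⧸ (bdry C F r p n).submoduleOf (cyc C F r p n)

theorem d_mem_cyc (r p : ℤ) (n : ℕ) (x : C.X (n + 1)) (hx : x ∈ cyc C F r p (n + 1)) :
    (C.d (n + 1) n).hom x ∈ cyc C F r (p + r) n := by
  refine ⟨hx.2, ?_⟩
  change (C.d n (n - 1)).hom ((C.d (n + 1) n).hom x) ∈ F (p + r + r) (n - 1)
  have h : (C.d n (n - 1)).hom ((C.d (n + 1) n).hom x) = 0 := by
    rw [← LinearMap.comp_apply, ← ModuleCat.hom_comp, C.d_comp_d]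
    rfl
  rw [h]
  exact Submodule.zero_mem _

/-- The differential `d_r : E_r^p → E_r^(p+r)`, from total degree `n + 1` to total degree `n`. -/
def pageD (r p : ℤ) (n : ℕ) : page C F r p (n + 1) →ₗ[R] page C F r (p + r) n :=
  Submodule.mapQ _ _ ((C.d (n + 1) n).hom.restrict fun x hx => d_mem_cyc C F r p n x hx) (by
    rintro ⟨x, hx⟩ h
    change x ∈ bdry C F r p (n + 1) at h
    change (C.d (n + 1) n).hom x ∈ bdry C F r (p + r) n
    obtain ⟨y, hy, z, hz, rfl⟩ := Submodule.mem_sup.mp h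
    obtain ⟨w, hw, rfl⟩ := hz
    have h0 : (C.d (n + 1) n).hom ((C.d (n + 2) (n + 1)).hom w) = 0 := by
      rw [← LinearMap.comp_apply, ← ModuleCat.hom_comp, C.d_comp_d]
      rfl
    rw [map_add, h0, add_zero]
    refine Submodule.mem_sup_right ⟨y, ?_, rfl⟩
    rw [show p + r - r + 1 = p + 1 by ring]
    exact hy)

end SpectralSequence

/-- The filtration by columns of `R/I ⊗ K(R; I^s) = ⨁_k R/I ⊗ Q^(k)`, the total complex of the
double complex with columns `R/I ⊗ Q^(k)`: the `p`-th step consists of the elements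
whose components in `R/I ⊗ Q^(k)` vanish for `k < p`. -/
def colFil (u : ι → R) (s : ℕ) (p : ℤ) (n : ℕ) :
    Submodule R ((tensC (R ⧸ idl u) (KComplex u s)).X n) :=
  ⨅ (k : Fin s) (_ : (k : ℤ) < p),
    LinearMap.ker (LinearMap.lTensor (R ⧸ idl u) (comp R ι s n k k.2))

/-! ### Products in Tor -/

section Product

variable (A B : Type u) [CommRing A] [Algebra R A] [CommRing B] [Algebra R B]

/-- A morphism of complexes `P ⊗ P → P` over the multiplication `B ⊗ B → B`, for a projective
resolution `P` of the `R`-algebra `B`, given by bilinear maps `P_m × P_n → P_k`, `m + n = k`. -/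
structure ResPairing {B : Type u} [CommRing B] [Algebra R B]
    (P : ProjectiveResolution (ModuleCat.of R B)) where
  mul : ∀ {m n k : ℕ}, m + n = k →
    (P.complex.X m →ₗ[R] P.complex.X n →ₗ[R] P.complex.X k)
  leibniz : ∀ (m n k : ℕ) (h : m + n = k) (x : P.complex.X (m + 1)) (y : P.complex.X (n + 1)),
    (P.complex.d (k + 2) (k + 1)).hom (mul (by omega : (m + 1) + (n + 1) = k + 2) x y) =
      mul (by omega : m + (n + 1) = k + 1) ((P.complex.d (m + 1) m).hom x) y +
      (-1 : R) ^ (m + 1) •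
        mul (by omega : (m + 1) + n = k + 1) x ((P.complex.d (n + 1) n).hom y)
  leibniz_zero_left : ∀ (n : ℕ) (x : P.complex.X 0) (y : P.complex.X (n + 1)),
    (P.complex.d (n + 1) n).hom (mul (zero_add (n + 1)) x y) =
      mul (zero_add n) x ((P.complex.d (n + 1) n).hom y)
  leibniz_zero_right : ∀ (m : ℕ) (x : P.complex.X (m + 1)) (y : P.complex.X 0),
    (P.complex.d (m + 1) m).hom (mul (add_zero (m + 1)) x y) =
      mul (add_zero m) ((P.complex.d (m + 1) m).hom x) y
  aug : ∀ x y : P.complex.X 0,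
    (ChainComplex.toSingle₀Equiv _ _ P.π).1.hom (mul (zero_add 0) x y) =
      ((ChainComplex.toSingle₀Equiv _ _ P.π).1.hom x *
        (ChainComplex.toSingle₀Equiv _ _ P.π).1.hom y : B)

/-- The element `a` of `C_n` is a cycle, with homology class `x`. -/
def IsClass (C : ChainComplex (ModuleCat.{u} R) ℕ) (n : ℕ) (a : C.X n) (x : C.homology n) : Prop :=
  ∃ c : C.cycles n, (C.iCycles n).hom c = a ∧ (C.homologyπ n).hom c = x

variable {A B}

/-- The pairing `(a ⊗ x, b ⊗ y) ↦ a b ⊗ x y` on `A ⊗ P`. -/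
def tensMul (P : ProjectiveResolution (ModuleCat.of R B)) (μ : ResPairing P) (m n : ℕ) :
    (A ⊗[R] P.complex.X m) →ₗ[R] (A ⊗[R] P.complex.X n) →ₗ[R] (A ⊗[R] P.complex.X (m + n)) :=
  TensorProduct.map₂ (LinearMap.mul R A) (μ.mul rfl)

/-- `z` is the product of `x` and `y` in the graded algebra `Tor_*^R(A, B)`: for some projective
resolution `P` of `B` with a pairing `P ⊗ P → P` over the multiplication of `B`, the classes `x`
and `y` are represented in `A ⊗ P` by cycles `a` and `b` with product representing `z`. -/
def IsTorProduct {m n : ℕ} (x : TorM R A B m) (y : TorM R A B n) (z : TorM R A B (m + n)) : Prop :=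
  ∃ (P : ProjectiveResolution (ModuleCat.of R B)) (μ : ResPairing P)
    (a : A ⊗[R] P.complex.X m) (b : A ⊗[R] P.complex.X n),
    IsClass (tensC A P.complex) m a ((torIso A P m).hom.hom x) ∧
    IsClass (tensC A P.complex) n b ((torIso A P n).hom.hom y) ∧
    IsClass (tensC A P.complex) (m + n) (tensMul P μ m n a b) ((torIso A P (m + n)).hom.hom z)

end Product

end RegularQuotient
end

open RegularQuotient

noncomputable section

set_option linter.unusedSectionVars false

namespace RegularQuotient

universe u

/-! ### Signs and basis elements -/

section

variable {R : Type u} [CommRing R] {ι : Type} [LinearOrder ι]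

/-! Two facts carry the argument. First, the coefficients of the differential of `Q^(p)` lie in `I`,
so this differential vanishes after tensoring with `R/I` (`lTensor_dQ`). Tor of `I^p/I^(p+1)` is
therefore `R/I ⊗ Q^(p)` itself, and `∂_*` is `R/I ⊗ ∂`. Second, `∂` is the Koszul differential of
the polynomial ring on the `ũ_i`, and it has an `R`-linear contracting homotopy in every positive
total degree: trade `ũ_i` for `e_i`, where `i` is the least index that occurs (`delHtpy`,
`del_delHtpy`). No integer is inverted, and the homotopy survives any tensor product; this gives the
exactness, the injectivity and the surjectivity of the `∂_*`.

Regularity is needed only for the resolutions. Koszul exactness in positive degrees follows by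
adjoining one `u_i` at a time (`exists_dQ_eq_of_mem_basSpan`). In degree zero quasi-regularity is
needed, and the homotopy supplies it: a form `x` of positive degree vanishing at `u` is `∂z`,
induction on the degree corrects `z` to a Koszul cycle `dv` (`exists_del_eq_of_evQ_eq_zero`), and
then `x = ∂dv = -d∂v`. For `K(R; I^s)`, cycles are cleared one column at a time
(`mem_range_dK_of_forall`).

In `R/I ⊗ K(R; I^s)` only `∂` remains, and it moves each column by exactly one step. Hence the `d_r`
with `r ≥ 2` vanish (`dT_mem_bdry`), and the second page is the homology of `∂`, which can survive
only in the last column and in column zero, degree zero (`cyc_two_le_bdry`). Likewise every cycle of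
positive degree is homologous to one in the last column (`exists_eq_inclT_add_dT`), and what bounds
there is the image of `∂` (`exists_dT_eq_inclT_iff`); this is the cokernel description.

For products, a chain map `P ⊗ P → P` is determined up to homotopy by what it covers on
augmentations, so the product does not depend on choices (`IsTorProduct.unique`). Classes of
positive degree come from `I^(s-1)/I^s`, whose image in `R/I^s` has square zero for `s ≥ 2`. The
pairing restricted to a resolution of this module lifts the zero map, so it is null-homotopic
(`isTorProduct_zero`). -/

theorem bas_eq_zero_of_card {p n : ℕ} {S : Finset ι} (m : ι →₀ ℕ) (h : S.card ≠ n) :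
    bas R p n S m = 0 := by simp [bas, h]

theorem sgn_mul_self (i : ι) (S : Finset ι) : sgn R i S * sgn R i S = 1 := by
  rw [sgn, ← mul_pow]
  simp

theorem sgn_of_forall_le {i : ι} {S : Finset ι} (h : ∀ j ∈ S, i ≤ j) : sgn R i S = 1 := by
  rw [sgn, Finset.filter_false_of_mem fun j hj => not_lt.mpr (h j hj)]
  simp

theorem sgn_insert_self (i : ι) (S : Finset ι) : sgn R i (insert i S) = sgn R i S := by
  rw [sgn, sgn, Finset.filter_insert, if_neg (lt_irrefl i)]

theorem sgn_erase_self (i : ι) (S : Finset ι) : sgn R i (S.erase i) = sgn R i S := by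
  rw [sgn, sgn, Finset.filter_erase, Finset.erase_eq_of_notMem (by simp)]

theorem sgn_insert_of_lt {i j : ι} {S : Finset ι} (hi : i ∉ S) (h : i < j) :
    sgn R j (insert i S) = -sgn R j S := by
  rw [sgn, sgn, Finset.filter_insert, if_pos h, Finset.card_insert_of_notMem (by simp [hi]),
    pow_succ, mul_neg_one]

/-! ### The contracting homotopy of `∂` -/

variable (R) in
/-- If `i` is the least index occurring in `e_S ũ^m`, this is `e_i e_S ũ^m / ũ_i`, or `0` if
`i ∈ S`. -/
def delHtpyBas (p n : ℕ) (S : Finset ι) (m : ι →₀ ℕ) : Q R ι p (n + 1) :=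
  if h : (S ∪ m.support).Nonempty then
    let i := (S ∪ m.support).min' h
    if i ∈ S then 0 else bas R p (n + 1) (insert i S) (m - Finsupp.single i 1)
  else 0

variable (R ι) in
/-- A contracting homotopy of the complex with terms `Q^(p)_n` and differential `∂`. -/
def delHtpy (p n : ℕ) : Q R ι (p + 1) n →ₗ[R] Q R ι p (n + 1) :=
  Finsupp.linearCombination R fun b => delHtpyBas R p n b.1.1 b.1.2

theorem delHtpy_bas_of_mem {p n : ℕ} {S : Finset ι} {m : ι →₀ ℕ} {i : ι} (hi : i ∈ S)
    (h : ∀ j ∈ S ∪ m.support, i ≤ j) : delHtpy R ι p n (bas R (p + 1) n S m) = 0 := by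
  by_cases hSm : S.card = n ∧ m.degree = p + 1
  · have hi' : i ∈ S ∪ m.support := Finset.mem_union_left _ hi
    have hmin : (S ∪ m.support).min' ⟨i, hi'⟩ = i :=
      le_antisymm (Finset.min'_le _ _ hi') (Finset.le_min' _ _ _ h)
    have hne : (S ∪ m.support).Nonempty := ⟨i, hi'⟩
    simp only [bas, hSm, and_self, dite_true, delHtpy, Finsupp.linearCombination_single, one_smul,
      delHtpyBas, hmin, hi, if_true, hne]
  · simp [bas, hSm]

theorem delHtpy_bas_of_notMem {p n : ℕ} {S : Finset ι} {m : ι →₀ ℕ} {i : ι} (hi : i ∉ S)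
    (h : ∀ j ∈ S ∪ m.support, i ≤ j) :
    delHtpy R ι p n (bas R (p + 1) n S (m + Finsupp.single i 1)) =
      bas R p (n + 1) (insert i S) m := by
  have hc := Finset.card_insert_of_notMem hi
  by_cases hSm : S.card = n ∧ m.degree = p
  · have hi' : i ∈ S ∪ (m + Finsupp.single i 1).support := by simp
    have hmin : (S ∪ (m + Finsupp.single i 1).support).min' ⟨i, hi'⟩ = i := by
      refine le_antisymm (Finset.min'_le _ _ hi') (Finset.le_min' _ _ _ fun j hj => ?_)
      by_cases hij : j = i
      · exact hij.ge
      · refine h j ?_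
        simpa [Finsupp.single_apply, Ne.symm hij] using hj
    have hne : (S ∪ (m + Finsupp.single i 1).support).Nonempty := ⟨i, hi'⟩
    have hdeg : (m + Finsupp.single i 1).degree = p + 1 := by simp [hSm.2]
    simp only [bas, hSm.1, hdeg, and_self, dite_true, delHtpy, Finsupp.linearCombination_single,
      one_smul, delHtpyBas, hne, hmin, hi, if_false, add_tsub_cancel_right]
  · have h1 : ¬ (S.card = n ∧ (m + Finsupp.single i 1).degree = p + 1) := by simpa using hSm
    have h2 : ¬ ((insert i S).card = n + 1 ∧ m.degree = p) := by simpa [hc] using hSm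
    simp only [bas, h1, h2, dite_false, map_zero]

/-- Erasing some `j ≠ i` leaves the least index in the exterior part, and the homotopy kills the
result. Only the term erasing `i` survives; its sign is `1` because `i` is least, and the homotopy
restores `e_i`. -/
theorem delHtpy_del_bas_of_mem {p n : ℕ} {S : Finset ι} {m : ι →₀ ℕ} {i : ι} (hi : i ∈ S)
    (hS : S.card = n + 1) (h : ∀ j ∈ S ∪ m.support, i ≤ j) :
    delHtpy R ι p n (del R ι p n (bas R p (n + 1) S m)) = bas R p (n + 1) S m := by
  rw [del_bas p n S m hS, map_sum, Finset.sum_eq_single_of_mem i hi]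
  · rw [map_smul, sgn_of_forall_le fun j hj => h j (Finset.mem_union_left _ hj), one_smul,
      delHtpy_bas_of_notMem (Finset.notMem_erase i S), Finset.insert_erase hi]
    intro j hj
    refine h j ?_
    rw [Finset.mem_union] at hj ⊢
    exact hj.imp_left Finset.mem_of_mem_erase
  · intro j hj hji
    rw [map_smul, delHtpy_bas_of_mem (i := i), smul_zero]
    · exact Finset.mem_erase.mpr ⟨hji.symm, hi⟩
    · intro k hk
      by_cases hkj : k = j
      · exact hkj ▸ h j (Finset.mem_union_left _ hj)
      · refine h k ?_
        simpa [hkj, Finsupp.single_apply, Ne.symm hkj] using hk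

/-- The leading term erases the `e_i` just inserted. The other terms change sign because `i`
precedes every `j ∈ S`; in `del_delHtpy` they cancel against the other composite. -/
theorem del_delHtpy_bas_of_notMem {p n : ℕ} {S : Finset ι} {m : ι →₀ ℕ} {i : ι} (hi : i ∉ S)
    (hS : S.card = n) (h : ∀ j ∈ S ∪ m.support, i ≤ j) :
    del R ι p n (delHtpy R ι p n (bas R (p + 1) n S (m + Finsupp.single i 1))) =
      bas R (p + 1) n S (m + Finsupp.single i 1) -
        ∑ j ∈ S, sgn R j S • bas R (p + 1) n (insert i (S.erase j)) (m + Finsupp.single j 1) := by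
  have hlt : ∀ j ∈ S, i < j := fun j hj =>
    lt_of_le_of_ne (h j (Finset.mem_union_left _ hj)) (fun hij => hi (hij ▸ hj))
  rw [delHtpy_bas_of_notMem hi h, del_bas p n _ _ (by rw [Finset.card_insert_of_notMem hi, hS]),
    Finset.sum_insert hi, sgn_insert_self, sgn_of_forall_le (fun j hj => (hlt j hj).le), one_smul,
    Finset.erase_insert hi, sub_eq_add_neg, ← Finset.sum_neg_distrib]
  congr 1
  refine Finset.sum_congr rfl fun j hj => ?_
  rw [sgn_insert_of_lt hi (hlt j hj), neg_smul, Finset.erase_insert_of_ne (hlt j hj).ne]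

/-- The least index is either exterior already or a polynomial factor that can be made exterior; the
homotopy pairs these two kinds of basis elements. In total degree zero no index occurs. -/
theorem exists_pivot {S : Finset ι} {m : ι →₀ ℕ} (h : S.card + m.degree ≠ 0) :
    ∃ i, (∀ j ∈ S ∪ m.support, i ≤ j) ∧
      (i ∈ S ∨ i ∉ S ∧ ∃ m', m = m' + Finsupp.single i 1) := by
  have hne : (S ∪ m.support).Nonempty := by
    rw [Finset.nonempty_iff_ne_empty]
    intro h'
    obtain ⟨h1, h2⟩ := Finset.union_eq_empty.mp h'
    rw [Finsupp.support_eq_empty] at h2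
    simp [h1, h2] at h
  refine ⟨(S ∪ m.support).min' hne, fun j hj => Finset.min'_le _ j hj, ?_⟩
  have hmem := Finset.min'_mem _ hne
  by_cases hS : (S ∪ m.support).min' hne ∈ S
  · exact Or.inl hS
  · refine Or.inr ⟨hS, m - Finsupp.single _ 1, (tsub_add_cancel_of_le ?_).symm⟩
    rw [Finsupp.single_le_iff]
    exact Nat.one_le_iff_ne_zero.mpr
      (Finsupp.mem_support_iff.mp ((Finset.mem_union.mp hmem).resolve_left hS))

theorem delHtpy_del_zero (n : ℕ) : delHtpy R ι 0 n ∘ₗ del R ι 0 n = LinearMap.id := by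
  refine Q_hom_ext fun S m hS hm => ?_
  obtain ⟨i, h, hi | ⟨_, m', rfl⟩⟩ := exists_pivot (S := S) (m := m) (by omega)
  · exact delHtpy_del_bas_of_mem hi hS h
  -- A polynomial pivot would give the monomial positive degree, which column zero excludes.
  · simp at hm

theorem del_delHtpy_zero (p : ℕ) : del R ι p 0 ∘ₗ delHtpy R ι p 0 = LinearMap.id := by
  refine Q_hom_ext fun S m hS hm => ?_
  obtain rfl := Finset.card_eq_zero.mp hS
  obtain ⟨i, h, hi | ⟨hi, m', rfl⟩⟩ := exists_pivot (S := ∅) (m := m) (by omega)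
  · simp at hi
  · rw [LinearMap.comp_apply, del_delHtpy_bas_of_notMem hi hS, Finset.sum_empty, sub_zero]
    · rfl
    · intro j hj
      refine h j ?_
      simp only [Finset.empty_union, Finsupp.mem_support_iff, Finsupp.add_apply] at hj ⊢
      omega

theorem del_delHtpy (p n : ℕ) :
    del R ι p (n + 1) ∘ₗ delHtpy R ι p (n + 1) + delHtpy R ι (p + 1) n ∘ₗ del R ι (p + 1) n =
      LinearMap.id := by
  refine Q_hom_ext fun S m hS hm => ?_
  obtain ⟨i, h, hi | ⟨hi, m', rfl⟩⟩ := exists_pivot (S := S) (m := m) (by omega)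
  · rw [LinearMap.add_apply, LinearMap.comp_apply, LinearMap.comp_apply,
      delHtpy_del_bas_of_mem hi hS h, delHtpy_bas_of_mem hi h, map_zero, zero_add]
    rfl
  · have h' : ∀ j ∈ S ∪ m'.support, i ≤ j := by
      intro j hj
      refine h j ?_
      simp only [Finset.mem_union, Finsupp.mem_support_iff, Finsupp.add_apply] at hj ⊢
      exact hj.imp_right fun hj' => by omega
    rw [LinearMap.add_apply, LinearMap.comp_apply, LinearMap.comp_apply,
      del_delHtpy_bas_of_notMem hi hS h', del_bas _ _ _ _ hS, map_sum, LinearMap.id_apply,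
      sub_add_eq_add_sub, sub_eq_iff_eq_add]
    congr 1
    refine Finset.sum_congr rfl fun j hj => ?_
    -- Moving `j` from the exterior to the polynomial part keeps `i` least, so the homotopy again
    -- trades `ũ_i` for `e_i`.
    rw [map_smul, add_right_comm m', delHtpy_bas_of_notMem]
    · exact fun hij => hi (Finset.mem_of_mem_erase hij)
    · intro k hk
      by_cases hkj : k = j
      · exact hkj ▸ h' j (Finset.mem_union_left _ hj)
      · refine h' k ?_
        simpa [hkj, Finsupp.single_apply, Ne.symm hkj] using hk

end

section

variable {R : Type u} [CommRing R] {ι : Type} [LinearOrder ι]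

/-! ### The Koszul complex of a regular sequence -/

variable (R) in
/-- Multiplication by `e_i`. -/
def wedge (p n : ℕ) (i : ι) : Q R ι p n →ₗ[R] Q R ι p (n + 1) :=
  Finsupp.linearCombination R fun b =>
    if i ∈ b.1.1 then 0 else sgn R i b.1.1 • bas R p (n + 1) (insert i b.1.1) b.1.2

variable (R) in
/-- Contraction with the `i`-th coordinate. -/
def contr (p n : ℕ) (i : ι) : Q R ι p (n + 1) →ₗ[R] Q R ι p n :=
  Finsupp.linearCombination R fun b =>
    if i ∈ b.1.1 then sgn R i b.1.1 • bas R p n (b.1.1.erase i) b.1.2 else 0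

theorem wedge_bas_of_mem {p n : ℕ} {i : ι} {S : Finset ι} (m : ι →₀ ℕ) (hi : i ∈ S) :
    wedge R p n i (bas R p n S m) = 0 := by
  by_cases h : S.card = n ∧ m.degree = p
  · simp [wedge, bas, h, hi]
  · simp [bas, h]

theorem wedge_bas_of_notMem {p n : ℕ} {i : ι} {S : Finset ι} (m : ι →₀ ℕ) (hi : i ∉ S) :
    wedge R p n i (bas R p n S m) = sgn R i S • bas R p (n + 1) (insert i S) m := by
  have hc := Finset.card_insert_of_notMem hi
  by_cases h : S.card = n ∧ m.degree = p
  · simp [wedge, bas, h, hi]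
  · have h' : ¬ ((insert i S).card = n + 1 ∧ m.degree = p) := by simpa [hc] using h
    simp only [bas, h, h', dite_false, map_zero, smul_zero]

theorem contr_bas_of_notMem {p n : ℕ} {i : ι} {S : Finset ι} (m : ι →₀ ℕ) (hi : i ∉ S) :
    contr R p n i (bas R p (n + 1) S m) = 0 := by
  by_cases h : S.card = n + 1 ∧ m.degree = p
  · simp [contr, bas, h, hi]
  · simp [bas, h]

theorem contr_bas_of_mem {p n : ℕ} {i : ι} {S : Finset ι} (m : ι →₀ ℕ) (hi : i ∈ S) :
    contr R p n i (bas R p (n + 1) S m) = sgn R i S • bas R p n (S.erase i) m := by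
  have hc := Finset.card_erase_add_one hi
  by_cases h : S.card = n + 1 ∧ m.degree = p
  · simp [contr, bas, h, hi]
  · have h' : ¬ ((S.erase i).card = n ∧ m.degree = p) := by
      rintro ⟨h1, h2⟩
      exact h ⟨by omega, h2⟩
    simp only [bas, h, h', dite_false, map_zero, smul_zero]

/-- Both maps delete exterior factors with alternating signs, and deleting `i` and `j` in the two
orders gives opposite signs (`sgn_swap`). The term `j = i` does not contribute. -/
theorem dQ_contr (u : ι → R) (p n : ℕ) (i : ι) :
    dQ u p n ∘ₗ contr R p (n + 1) i = -(contr R p n i ∘ₗ dQ u p (n + 1)) := by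
  refine Q_hom_ext fun S m hS _ => ?_
  rw [LinearMap.neg_apply, LinearMap.comp_apply, LinearMap.comp_apply, dQ_bas _ _ _ _ _ hS, map_sum]
  by_cases hi : i ∈ S
  · rw [contr_bas_of_mem m hi, map_smul, dQ_bas _ _ _ _ _ (card_erase' hS hi), Finset.smul_sum,
      ← Finset.add_sum_erase S _ hi, map_smul, contr_bas_of_notMem m (Finset.notMem_erase i S),
      smul_zero, zero_add, ← Finset.sum_neg_distrib]
    refine Finset.sum_congr rfl fun j hj => ?_
    obtain ⟨hji, hj⟩ := Finset.mem_erase.mp hj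
    rw [map_smul, contr_bas_of_mem m (Finset.mem_erase.mpr ⟨hji.symm, hi⟩), smul_smul, smul_smul,
      ← mul_assoc, sgn_swap hi hj hji.symm, Finset.erase_right_comm, ← neg_smul]
    congr 1
    ring
  · rw [contr_bas_of_notMem m hi, map_zero, Finset.sum_eq_zero, neg_zero]
    intro j _
    rw [map_smul, contr_bas_of_notMem m fun h => hi (Finset.mem_of_mem_erase h), smul_zero]

theorem dQ_wedge_bas (u : ι → R) (p n : ℕ) {i : ι} {S : Finset ι} (m : ι →₀ ℕ) (hi : i ∉ S)
    (hS : S.card = n) :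
    dQ u p n (wedge R p n i (bas R p n S m)) = u i • bas R p n S m -
      ∑ j ∈ S, (sgn R j S * u j * sgn R i (S.erase j)) • bas R p n (insert i (S.erase j)) m := by
  have hS' : (insert i S).card = n + 1 := by rw [Finset.card_insert_of_notMem hi, hS]
  rw [wedge_bas_of_notMem m hi, map_smul, dQ_bas _ _ _ _ _ hS', Finset.sum_insert hi,
    Finset.erase_insert hi, smul_add, smul_smul, sgn_insert_self, ← mul_assoc, sgn_mul_self,
    one_mul, sub_eq_add_neg, ← Finset.sum_neg_distrib, Finset.smul_sum]
  congr 1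
  refine Finset.sum_congr rfl fun j hj => ?_
  have hij : i ≠ j := fun h => hi (h ▸ hj)
  rw [Finset.erase_insert_of_ne hij, smul_smul, ← neg_smul, ← sgn_insert_self i (S.erase j)]
  congr 1
  have h := sgn_swap (R := R) (Finset.mem_insert_self i S) (Finset.mem_insert_of_mem hj) hij
  rw [Finset.erase_insert hi, Finset.erase_insert_of_ne hij, sgn_insert_self] at h
  have h1 := sgn_mul_self (R := R) j S
  have h2 := sgn_mul_self (R := R) j (insert i S)
  -- The swap relation is multiplied by both signs of `j`, each of which squares to `1`.
  linear_combination (u j * sgn R j S * sgn R j (insert i S)) * h -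
    u j * sgn R i S * sgn R j (insert i S) * h1 -
    u j * sgn R i (insert i (S.erase j)) * sgn R j S * h2

theorem dQ_wedge_zero (u : ι → R) (p : ℕ) (i : ι) :
    dQ u p 0 ∘ₗ wedge R p 0 i = u i • LinearMap.id := by
  refine Q_hom_ext fun S m hS _ => ?_
  obtain rfl := Finset.card_eq_zero.mp hS
  rw [LinearMap.comp_apply, dQ_wedge_bas u p 0 m (Finset.notMem_empty i) hS, Finset.sum_empty,
    sub_zero]
  rfl

/-- This is the Leibniz rule for `e_i`: multiplication by `e_i` is a homotopy from `u_i` to zero. -/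
theorem dQ_wedge (u : ι → R) (p n : ℕ) (i : ι) :
    dQ u p (n + 1) ∘ₗ wedge R p (n + 1) i =
      u i • LinearMap.id - wedge R p n i ∘ₗ dQ u p n := by
  refine Q_hom_ext fun S m hS _ => ?_
  rw [LinearMap.comp_apply, LinearMap.sub_apply, LinearMap.comp_apply, dQ_bas _ _ _ _ _ hS, map_sum,
    LinearMap.smul_apply, LinearMap.id_apply]
  by_cases hi : i ∈ S
  · rw [wedge_bas_of_mem m hi, map_zero, Finset.sum_eq_single_of_mem i hi, map_smul,
      wedge_bas_of_notMem m (Finset.notMem_erase i S), Finset.insert_erase hi, smul_smul,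
      sgn_erase_self, mul_right_comm, sgn_mul_self, one_mul, sub_self]
    intro j _ hji
    rw [map_smul, wedge_bas_of_mem m (Finset.mem_erase.mpr ⟨hji.symm, hi⟩), smul_zero]
  · rw [dQ_wedge_bas u p _ m hi hS]
    congr 1
    refine Finset.sum_congr rfl fun j _ => ?_
    rw [map_smul, wedge_bas_of_notMem m fun h => hi (Finset.mem_of_mem_erase h), smul_smul]

variable (R) in
/-- The span of the basis elements `e_S ũ^m` with `S ⊆ T`. -/
def basSpan (T : Finset ι) (p n : ℕ) : Submodule R (Q R ι p n) :=
  Submodule.span R {x | ∃ S m, S ⊆ T ∧ bas R p n S m = x}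

theorem bas_mem_basSpan {T S : Finset ι} (p n : ℕ) (m : ι →₀ ℕ) (h : S ⊆ T) :
    bas R p n S m ∈ basSpan R T p n :=
  Submodule.subset_span ⟨S, m, h, rfl⟩

theorem map_mem_of_mem_basSpan {M : Type*} [AddCommGroup M] [Module R M] {T : Finset ι} {p n : ℕ}
    {f : Q R ι p n →ₗ[R] M} {N : Submodule R M} {x : Q R ι p n} (hx : x ∈ basSpan R T p n)
    (h : ∀ S m, S ⊆ T → f (bas R p n S m) ∈ N) : f x ∈ N := by
  have : basSpan R T p n ≤ N.comap f := by
    refine Submodule.span_le.mpr ?_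
    rintro _ ⟨S, m, hS, rfl⟩
    exact h S m hS
  exact this hx

theorem wedge_mem_basSpan {T : Finset ι} {p n : ℕ} {i : ι} {x : Q R ι p n}
    (hx : x ∈ basSpan R T p n) : wedge R p n i x ∈ basSpan R (insert i T) p (n + 1) := by
  refine map_mem_of_mem_basSpan hx fun S m hST => ?_
  by_cases hi : i ∈ S
  · rw [wedge_bas_of_mem m hi]
    exact Submodule.zero_mem _
  · rw [wedge_bas_of_notMem m hi]
    exact Submodule.smul_mem _ _ (bas_mem_basSpan _ _ _ (Finset.insert_subset_insert i hST))

theorem contr_mem_basSpan {T : Finset ι} {p n : ℕ} {i : ι} {x : Q R ι p (n + 1)}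
    (hx : x ∈ basSpan R (insert i T) p (n + 1)) : contr R p n i x ∈ basSpan R T p n := by
  refine map_mem_of_mem_basSpan hx fun S m hST => ?_
  by_cases hi : i ∈ S
  · rw [contr_bas_of_mem m hi]
    refine Submodule.smul_mem _ _ (bas_mem_basSpan _ _ _ ?_)
    rwa [← Finset.subset_insert_iff]
  · rw [contr_bas_of_notMem m hi]
    exact Submodule.zero_mem _

/-- Used to split `x = a + e_i c` with `a` free of `e_i`; the contraction recovers `c`. -/
theorem sub_wedge_contr_mem_basSpan {T : Finset ι} {p n : ℕ} {i : ι} {x : Q R ι p (n + 1)}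
    (hx : x ∈ basSpan R (insert i T) p (n + 1)) :
    x - wedge R p n i (contr R p n i x) ∈ basSpan R T p (n + 1) := by
  refine map_mem_of_mem_basSpan (f := LinearMap.id - wedge R p n i ∘ₗ contr R p n i) hx
    fun S m hST => ?_
  rw [LinearMap.sub_apply, LinearMap.comp_apply, LinearMap.id_apply]
  by_cases hi : i ∈ S
  · rw [contr_bas_of_mem m hi, map_smul, wedge_bas_of_notMem m (Finset.notMem_erase i S),
      smul_smul, sgn_erase_self, sgn_mul_self, one_smul, Finset.insert_erase hi, sub_self]
    exact Submodule.zero_mem _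
  · rw [contr_bas_of_notMem m hi, map_zero, sub_zero]
    exact bas_mem_basSpan _ _ _ ((Finset.subset_insert_iff_of_notMem hi).mp hST)

theorem basSpan_mono {T T' : Finset ι} (h : T ⊆ T') (p n : ℕ) :
    basSpan R T p n ≤ basSpan R T' p n :=
  Submodule.span_mono fun _ ⟨S, m, hS, hx⟩ => ⟨S, m, hS.trans h, hx⟩

theorem coeff_dQ_mem (u : ι → R) {T : Finset ι} {p n : ℕ} {x : Q R ι p (n + 1)}
    (hx : x ∈ basSpan R T p (n + 1)) (c : QIdx ι p n) :
    dQ u p n x c ∈ Ideal.span (u '' (T : Set ι)) := by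
  refine map_mem_of_mem_basSpan (f := Finsupp.lapply c ∘ₗ dQ u p n) hx fun S m hST => ?_
  by_cases hS : S.card = n + 1
  · rw [LinearMap.comp_apply, dQ_bas _ _ _ _ _ hS, map_sum]
    refine Submodule.sum_mem _ fun i hi => ?_
    rw [map_smul, smul_eq_mul]
    refine Ideal.mul_mem_right _ _ (Ideal.mul_mem_left _ _ ?_)
    exact Ideal.subset_span ⟨i, hST hi, rfl⟩
  · rw [bas_eq_zero_of_card m hS, map_zero]
    exact Submodule.zero_mem _

/-- Each generator `u_i` of the ideal is realised by multiplication by `e_i`, since `d(e_i x) = u_i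
x` in degree zero. -/
theorem exists_dQ_eq_of_coeff_mem (u : ι → R) {T : Finset ι} {p : ℕ} {x : Q R ι p 0}
    (hx : ∀ c, x c ∈ Ideal.span (u '' (T : Set ι))) :
    ∃ y ∈ basSpan R T p 1, dQ u p 0 y = x := by
  change x ∈ (basSpan R T p 1).map (dQ u p 0)
  rw [← Finsupp.sum_single x]
  refine Submodule.sum_mem _ fun c _ => ?_
  have h : Ideal.span (u '' (T : Set ι)) ≤
      ((basSpan R T p 1).map (dQ u p 0)).comap (Finsupp.lsingle c) := by
    refine Ideal.span_le.mpr ?_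
    rintro _ ⟨i, hi, rfl⟩
    obtain ⟨⟨S, m⟩, hS, hm⟩ := c
    obtain rfl := Finset.card_eq_zero.mp hS
    refine ⟨wedge R p 0 i (bas R p 0 ∅ m), ?_, ?_⟩
    · rw [wedge_bas_of_notMem m (Finset.notMem_empty i)]
      refine Submodule.smul_mem _ _ (bas_mem_basSpan _ _ _ ?_)
      simpa using hi
    · refine (LinearMap.congr_fun (dQ_wedge_zero u p i) _).trans ?_
      simp [bas, hm]
  exact h (hx c)

/-- The induction removes the largest index `i` of `T`. Because `T` is a lower set, the remaining
indices are all those below `i`, so the hypothesis on `u_i` refers to exactly the ideal they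
generate. -/
theorem exists_dQ_eq_of_mem_basSpan {u : ι → R} (hu : IsRegularSeq u) (p : ℕ) (T : Finset ι) :
    IsLowerSet (T : Set ι) → ∀ (n : ℕ) (x : Q R ι p (n + 1)), x ∈ basSpan R T p (n + 1) →
      dQ u p n x = 0 → ∃ y ∈ basSpan R T p (n + 2), dQ u p (n + 1) y = x := by
  induction T using Finset.induction_on_max with
  | empty =>
    intro _ n x hx _
    refine ⟨0, Submodule.zero_mem _, ?_⟩
    rw [map_zero, eq_comm, ← Submodule.mem_bot R]
    -- Without indices every spanning element of positive exterior degree is the default value `0`.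
    refine map_mem_of_mem_basSpan (f := LinearMap.id) hx fun S m hS => ?_
    rw [Finset.subset_empty.mp hS, bas_eq_zero_of_card m (by simp), map_zero]
    exact Submodule.zero_mem _
  | insert i T hi ih =>
    intro hT n x hx hdx
    have hT' : (T : Set ι) = Set.Iio i := by
      ext j
      refine ⟨fun hj => hi j hj, fun hj => ?_⟩
      exact Finset.mem_of_mem_insert_of_ne (hT (le_of_lt hj) (Finset.mem_insert_self i T)) hj.ne
    have ih' := ih (hT' ▸ isLowerSet_Iio i)
    have ha := sub_wedge_contr_mem_basSpan hx
    have hc := contr_mem_basSpan hx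
    -- The coefficient of `e_i` bounds without using `e_i`. In degree zero, `dx = 0` puts `u_i`
    -- times it into the ideal of the smaller indices, and regularity cancels `u_i`; in higher
    -- degrees it is a cycle and the induction hypothesis applies.
    obtain ⟨c, hcT, hdc⟩ : ∃ c ∈ basSpan R T p (n + 1), dQ u p n c = contr R p n i x := by
      cases n with
      | zero =>
        refine exists_dQ_eq_of_coeff_mem u fun c => ?_
        have h1 := LinearMap.congr_fun (dQ_wedge_zero u p i) (contr R p 0 i x)
        have h2 := coeff_dQ_mem u ha c
        rw [map_sub, hdx, zero_sub, Finsupp.neg_apply, neg_mem_iff] at h2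
        rw [LinearMap.comp_apply] at h1
        rw [h1, hT'] at h2
        rw [hT']
        have h3 : u i • (Ideal.Quotient.mk (Ideal.span (u '' Set.Iio i)) (contr R p 0 i x c)) =
            u i • 0 := by
          rw [smul_zero, ← Ideal.Quotient.mk_eq_mk, ← Submodule.Quotient.mk_smul,
            Submodule.Quotient.mk_eq_zero]
          exact h2
        exact Ideal.Quotient.eq_zero_iff_mem.mp (hu.isSMulRegular i h3)
      | succ n =>
        refine ih' n _ hc ?_
        have h := LinearMap.congr_fun (dQ_contr u p n i) x
        rw [LinearMap.comp_apply] at h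
        rw [h, LinearMap.neg_apply, LinearMap.comp_apply, hdx, map_zero, neg_zero]
    have h1 := LinearMap.congr_fun (dQ_wedge u p n i) c
    rw [LinearMap.comp_apply, LinearMap.sub_apply, LinearMap.comp_apply, hdc, LinearMap.smul_apply,
      LinearMap.id_apply] at h1
    -- Adding `d(e_i c) = u_i c - e_i dc` cancels the part of `x` divisible by `e_i`.
    have h2 : x + dQ u p (n + 1) (wedge R p (n + 1) i c) ∈ basSpan R T p (n + 1) := by
      rw [h1, add_sub_left_comm]
      exact Submodule.add_mem _ (Submodule.smul_mem _ _ hcT) ha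
    obtain ⟨y, hy, hdy⟩ := ih' n _ h2 (by
      rw [map_add, hdx, zero_add]
      exact LinearMap.congr_fun (dQ_dQ u p n) _)
    refine ⟨y - wedge R p (n + 1) i c, Submodule.sub_mem _
      (basSpan_mono (Finset.subset_insert i T) _ _ hy) (wedge_mem_basSpan hcT), ?_⟩
    rw [map_sub, hdy, add_sub_cancel_right]

/-- An element involves finitely many indices, and their downward closure is finite because initial
segments are. This reduces an infinite sequence to a finite one. -/
theorem exists_mem_basSpan [∀ i : ι, Finite (Set.Iio i)] {p n : ℕ} (x : Q R ι p n) :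
    ∃ T : Finset ι, IsLowerSet (T : Set ι) ∧ x ∈ basSpan R T p n := by
  have hfin : ∀ i : ι, (Set.Iic i).Finite := fun i => by
    rw [← Set.Iio_insert]
    exact (Set.toFinite _).insert i
  have hT : (⋃ b ∈ x.support, ⋃ i ∈ b.1.1, Set.Iic i).Finite :=
    x.support.finite_toSet.biUnion fun b _ => b.1.1.finite_toSet.biUnion fun i _ => hfin i
  refine ⟨hT.toFinset, ?_, ?_⟩
  · rw [Set.Finite.coe_toFinset]
    exact isLowerSet_iUnion₂ fun b _ => isLowerSet_iUnion₂ fun i _ => isLowerSet_Iic i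
  · suffices h : x.sum Finsupp.single ∈ basSpan R hT.toFinset p n by rwa [Finsupp.sum_single] at h
    refine Submodule.sum_mem _ fun b hb => ?_
    rw [← mul_one (x b), ← smul_eq_mul, ← Finsupp.smul_single, single_eq_bas]
    refine Submodule.smul_mem _ _ (bas_mem_basSpan _ _ _ fun i hi => ?_)
    rw [Set.Finite.mem_toFinset]
    exact Set.mem_iUnion₂.mpr ⟨b, hb, Set.mem_iUnion₂.mpr ⟨i, hi, le_rfl⟩⟩

/-- The Koszul complex of a regular sequence is exact in positive degrees. -/
theorem dQ_exact {u : ι → R} (hu : IsRegularSeq u) (p n : ℕ) :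
    Function.Exact (dQ u p (n + 1)) (dQ u p n) := by
  intro x
  constructor
  · intro hx
    have := fun i => (hu.finite_Iio i).to_subtype
    obtain ⟨T, hT, hxT⟩ := exists_mem_basSpan x
    obtain ⟨y, -, hy⟩ := exists_dQ_eq_of_mem_basSpan hu p T hT n x hxT hx
    exact ⟨y, hy⟩
  · rintro ⟨y, rfl⟩
    exact LinearMap.congr_fun (dQ_dQ u p n) y

end

section

variable {R : Type u} [CommRing R] {ι : Type} [LinearOrder ι]

/-! ### The resolutions `Q^(p)` and `K(R; I^s)` -/

theorem quasiIso_toSingle₀ {C : ChainComplex (ModuleCat.{u} R) ℕ} {M : ModuleCat.{u} R}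
    (ε : C.X 0 ⟶ M) (hε : C.d 1 0 ≫ ε = 0) (hsurj : Function.Surjective ε.hom)
    (h0 : Function.Exact (C.d 1 0).hom ε.hom)
    (h : ∀ n, Function.Exact (C.d (n + 2) (n + 1)).hom (C.d (n + 1) n).hom) :
    QuasiIso ((ChainComplex.toSingle₀Equiv C M).symm ⟨ε, hε⟩) where
  quasiIsoAt n := by
    cases n with
    | zero =>
      have hex : (ShortComplex.mk _ _ hε).Exact :=
        (ShortComplex.ShortExact.moduleCat_exact_iff_function_exact _).mpr h0
      have hepi : Epi ε := (ModuleCat.epi_iff_surjective ε).mpr hsurj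
      rw [ChainComplex.quasiIsoAt₀_iff, ShortComplex.quasiIso_iff_of_zeros']
      · refine (ShortComplex.exact_and_epi_g_iff_of_iso ?_).2 ⟨hex, hepi⟩
        exact ShortComplex.isoMk (Iso.refl _) (Iso.refl _) (Iso.refl _)
          ((Category.id_comp _).trans (Category.comp_id _).symm)
          (by
            simp only [Iso.refl_hom, HomologicalComplex.shortComplexFunctor'_map_τ₂,
              ChainComplex.toSingle₀Equiv_symm_apply_f_zero]
            exact (Category.id_comp ε).trans (Category.comp_id ε).symm)
      · exact C.shape _ _ (by simp)
      all_goals rfl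
    | succ n =>
      rw [quasiIsoAt_iff_exactAt' _ _ (ChainComplex.exactAt_succ_single_obj _ _),
        HomologicalComplex.exactAt_iff' _ (n + 2) (n + 1) n (by simp) (by simp)]
      exact (ShortComplex.ShortExact.moduleCat_exact_iff_function_exact _).mpr (h n)

theorem dQ_del_apply (u : ι → R) (p n : ℕ) (x : Q R ι p (n + 2)) :
    dQ u (p + 1) n (del R ι p (n + 1) x) = -del R ι p n (dQ u p (n + 1) x) :=
  eq_neg_of_add_eq_zero_left (LinearMap.congr_fun (dQ_del u p n) x)

theorem evQ_mem (u : ι → R) (p : ℕ) (x : Q R ι p 0) : evQ u p x ∈ idl u ^ p := by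
  rw [evQ, Finsupp.linearCombination_apply]
  exact Submodule.sum_mem _ fun b _ => Ideal.mul_mem_left _ _ (mon_mem' u b.2.2)

theorem augQ_apply (u : ι → R) (p : ℕ) (x : Q R ι p 0) :
    augQ u p x = Submodule.Quotient.mk ⟨evQ u p x, evQ_mem u p x⟩ := by
  have h : augQ u p = Submodule.mkQ _ ∘ₗ (evQ u p).codRestrict _ (evQ_mem u p) := by
    refine Finsupp.lhom_ext' fun b => LinearMap.ext_ring ?_
    simp only [LinearMap.comp_apply, Finsupp.lsingle_apply, augQ,
      Finsupp.linearCombination_single, one_smul, Submodule.mkQ_apply]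
    congr 2
    simp [evQ]
  rw [h]
  rfl

theorem augQ_eq_zero_iff (u : ι → R) (p : ℕ) (x : Q R ι p 0) :
    augQ u p x = 0 ↔ evQ u p x ∈ idl u ^ (p + 1) := by
  rw [augQ_apply, Submodule.Quotient.mk_eq_zero]
  rfl

theorem evQ_wedge (u : ι → R) (p : ℕ) (i : ι) (x : Q R ι p 0) :
    evQ u p (dQ u p 0 (wedge R p 0 i x)) = u i * evQ u p x := by
  rw [← smul_eq_mul, ← map_smul]
  exact congrArg _ (LinearMap.congr_fun (dQ_wedge_zero u p i) x)

/-- Since `I^(p+1) = I · I^p`, it suffices that `u_i` times the value of `x` is the value of the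
boundary of `e_i x`. -/
theorem idl_pow_succ_le (u : ι → R) (p : ℕ) (h : idl u ^ p ≤ LinearMap.range (evQ u p)) :
    idl u ^ (p + 1) ≤ LinearMap.range (evQ u p ∘ₗ dQ u p 0) := by
  rw [pow_succ', Ideal.mul_le]
  intro r hr s hs
  obtain ⟨x, rfl⟩ := h hs
  induction hr using Submodule.span_induction with
  | mem r hr =>
    obtain ⟨i, rfl⟩ := hr
    exact ⟨wedge R p 0 i x, evQ_wedge u p i x⟩
  | zero => simp
  | add r r' _ _ hr hr' => rw [add_mul]; exact Submodule.add_mem _ hr hr'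
  | smul a r _ hr => rw [smul_mul_assoc]; exact Submodule.smul_mem _ _ hr

theorem idl_pow_le_range_evQ (u : ι → R) (p : ℕ) : idl u ^ p ≤ LinearMap.range (evQ u p) := by
  induction p with
  | zero =>
    intro r _
    refine ⟨r • bas R 0 0 ∅ 0, ?_⟩
    rw [map_smul, evQ_bas u 0 ∅ 0 rfl (by simp)]
    simp [mon]
  | succ p ih =>
    intro r hr
    obtain ⟨x, hx⟩ := idl_pow_succ_le u p ih hr
    exact ⟨del R ι p 0 x, (evQ_del u p x).trans hx⟩

theorem exists_evQ_dQ_eq (u : ι → R) (p : ℕ) {r : R} (hr : r ∈ idl u ^ (p + 1)) :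
    ∃ x, evQ u p (dQ u p 0 x) = r :=
  idl_pow_succ_le u p (idl_pow_le_range_evQ u p) hr

theorem augQ_surjective (u : ι → R) (p : ℕ) : Function.Surjective (augQ u p) := by
  intro y
  obtain ⟨⟨r, hr⟩, rfl⟩ := Submodule.Quotient.mk_surjective _ y
  obtain ⟨x, rfl⟩ := idl_pow_le_range_evQ u p hr
  exact ⟨x, augQ_apply u p x⟩

/-- In degree zero, column zero has a single basis element, and its value is `1`. -/
theorem evQ_zero_injective (u : ι → R) : Function.Injective (evQ u 0) := by
  have huniq : ∀ b : QIdx ι 0 0, b = ⟨(∅, 0), rfl, by simp⟩ := fun ⟨⟨S, m⟩, hS, hm⟩ => by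
    obtain rfl := Finset.card_eq_zero.mp hS
    obtain rfl := (Finsupp.degree_eq_zero_iff m).mp hm
    rfl
  intro x y h
  have key : ∀ x : Q R ι 0 0, evQ u 0 x = x ⟨(∅, 0), rfl, by simp⟩ := fun x => by
    refine LinearMap.congr_fun (g := Finsupp.lapply _) (Q_hom_ext fun S m hS hm => ?_) x
    obtain rfl := Finset.card_eq_zero.mp hS
    obtain rfl := (Finsupp.degree_eq_zero_iff m).mp hm
    rw [evQ_bas u 0 ∅ 0 rfl (by simp)]
    simp [mon, bas]
  ext b
  rw [huniq b, ← key, ← key, h]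

/-- The relations between the monomials of degree `p + 1` in a regular sequence are generated by
the obvious ones. -/
theorem exists_del_eq_of_evQ_eq_zero {u : ι → R} (hu : IsRegularSeq u) (p : ℕ) :
    ∀ x : Q R ι (p + 1) 0, evQ u (p + 1) x = 0 → ∃ z, del R ι p 0 z = x ∧ dQ u p 0 z = 0 := by
  induction p with
  | zero =>
    intro x hx
    have h := LinearMap.congr_fun (del_delHtpy_zero (R := R) (ι := ι) 0) x
    rw [LinearMap.comp_apply, LinearMap.id_apply] at h
    refine ⟨_, h, evQ_zero_injective u ?_⟩
    rw [← evQ_del, h, hx, map_zero]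
  | succ p ih =>
    intro x hx
    have h := LinearMap.congr_fun (del_delHtpy_zero (R := R) (ι := ι) (p + 1)) x
    rw [LinearMap.comp_apply, LinearMap.id_apply] at h
    -- The homotopy gives `z` with `∂z = x`. Since `d` and `∂` agree after evaluation, `dz` has
    -- value zero and lower polynomial degree.
    obtain ⟨w, hw, hdw⟩ := ih (dQ u (p + 1) 0 (delHtpy R ι (p + 1) 0 x))
      (by rw [← evQ_del, h, hx])
    obtain ⟨v, rfl⟩ := (dQ_exact hu p 0 w).mp hdw
    -- Here `dz = ∂w` and `w = dv`, so `d∂v = -∂dv = -dz`, while `∂∂v = 0` leaves `∂z` unchanged.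
    refine ⟨delHtpy R ι (p + 1) 0 x + del R ι p 1 v, ?_, ?_⟩
    · rw [map_add, h]
      exact add_eq_left.mpr (LinearMap.congr_fun (del_del (R := R) (ι := ι) p 0) v)
    · rw [map_add, dQ_del_apply, hw, add_neg_cancel]

/-- In positive polynomial degree `x = ∂z` with `z` a cycle, hence `z = dv` and `x = -d∂v`. -/
theorem exists_dQ_eq_of_evQ_eq_zero {u : ι → R} (hu : IsRegularSeq u) (p : ℕ)
    (x : Q R ι p 0) (hx : evQ u p x = 0) : ∃ y, dQ u p 0 y = x := by
  cases p with
  | zero =>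
    refine ⟨0, evQ_zero_injective u ?_⟩
    rw [hx, map_zero, map_zero]
  | succ p =>
    obtain ⟨z, rfl, hz⟩ := exists_del_eq_of_evQ_eq_zero hu p x hx
    obtain ⟨v, rfl⟩ := (dQ_exact hu p 0 z).mp hz
    refine ⟨-del R ι p 1 v, ?_⟩
    rw [map_neg, dQ_del_apply, neg_neg]

/-- A regular sequence is quasi-regular. -/
theorem augQ_exact {u : ι → R} (hu : IsRegularSeq u) (p : ℕ) :
    Function.Exact (dQ u p 0) (augQ u p) := by
  intro x
  constructor
  · intro hx
    -- Every element of `I^(p+1)` is the value of a boundary; subtracting that boundary leaves value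
    -- exactly zero.
    obtain ⟨v, hv⟩ := exists_evQ_dQ_eq u p ((augQ_eq_zero_iff u p x).mp hx)
    obtain ⟨y, hy⟩ := exists_dQ_eq_of_evQ_eq_zero hu p (x - dQ u p 0 v)
      (by rw [map_sub, hv, sub_self])
    exact ⟨y + v, by rw [map_add, hy, sub_add_cancel]⟩
  · rintro ⟨y, rfl⟩
    exact LinearMap.congr_fun (augQ_dQ u p) y

theorem quasiIso_QAug {u : ι → R} (hu : IsRegularSeq u) (p : ℕ) : QuasiIso (QAug u p) := by
  refine quasiIso_toSingle₀ _ _ (augQ_surjective u p) ?_ fun n => ?_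
  · rw [QComplex_d u p 0]
    exact augQ_exact hu p
  · rw [QComplex_d u p n, QComplex_d u p (n + 1)]
    exact dQ_exact hu p n

variable (R ι) in
/-- The inclusion of `Q^(k)_n` in `K(R; I^s)_n`. -/
abbrev inclK (s n : ℕ) (k : Fin s) : Q R ι k n →ₗ[R] K R ι s n :=
  LinearMap.single R (fun k : Fin s => Q R ι k n) k

theorem comp_inclK_self (s n k : ℕ) (hk : k < s) (x : Q R ι k n) :
    comp R ι s n k hk (inclK R ι s n ⟨k, hk⟩ x) = x :=
  Pi.single_eq_same (M := fun k : Fin s => Q R ι k n) ⟨k, hk⟩ x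

theorem comp_inclK_of_ne (s n : ℕ) {k j : ℕ} (hk : k < s) (hj : j < s) (h : j ≠ k)
    (x : Q R ι k n) : comp R ι s n j hj (inclK R ι s n ⟨k, hk⟩ x) = 0 :=
  Pi.single_eq_of_ne (M := fun k : Fin s => Q R ι k n) (i := ⟨k, hk⟩) (i' := ⟨j, hj⟩)
    (fun h' => h (Fin.mk.inj_iff.mp h')) x

theorem K_ext {s n : ℕ} {x y : K R ι s n}
    (h : ∀ k (hk : k < s), comp R ι s n k hk x = comp R ι s n k hk y) : x = y :=
  funext fun k => h k k.2

theorem augK_apply (u : ι → R) (s : ℕ) (x : K R ι s 0) :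
    augK u s x = Submodule.mkQ (idl u ^ s)
      (∑ k : Fin s, (-1 : R) ^ (k : ℕ) * evQ u k (comp R ι s 0 k k.2 x)) := by
  rw [map_sum, augK, LinearMap.sum_apply]
  refine Finset.sum_congr rfl fun k _ => ?_
  rw [← smul_eq_mul, map_smul]
  rfl

theorem dKcomp_inclK_of_lt (u : ι → R) {s n k j : ℕ} (hk : k < s) (hj : j < s) (h : j < k)
    (x : Q R ι k (n + 1)) : dKcomp u s n j hj (inclK R ι s (n + 1) ⟨k, hk⟩ x) = 0 := by
  cases j with
  | zero => rw [dKcomp, LinearMap.comp_apply, comp_inclK_of_ne _ _ _ _ h.ne, map_zero]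
  | succ j =>
    rw [dKcomp, LinearMap.add_apply, LinearMap.comp_apply, LinearMap.comp_apply,
      comp_inclK_of_ne _ _ _ _ (by omega), comp_inclK_of_ne _ _ _ _ h.ne, map_zero, map_zero,
      add_zero]

theorem dKcomp_inclK_self (u : ι → R) {s n k : ℕ} (hk : k < s) (x : Q R ι k (n + 1)) :
    dKcomp u s n k hk (inclK R ι s (n + 1) ⟨k, hk⟩ x) = dQ u k n x := by
  cases k with
  | zero => rw [dKcomp, LinearMap.comp_apply, comp_inclK_self]
  | succ k =>
    rw [dKcomp, LinearMap.add_apply, LinearMap.comp_apply, LinearMap.comp_apply,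
      comp_inclK_of_ne _ _ _ _ (by omega), comp_inclK_self, map_zero, zero_add]

theorem dKcomp_of_comp_eq_zero (u : ι → R) {s n k : ℕ} (hk : k < s) {x : K R ι s (n + 1)}
    (hx : ∀ j (hj : j < s), j < k → comp R ι s (n + 1) j hj x = 0) :
    dKcomp u s n k hk x = dQ u k n (comp R ι s (n + 1) k hk x) := by
  cases k with
  | zero => rfl
  | succ k =>
    rw [dKcomp, LinearMap.add_apply, LinearMap.comp_apply, LinearMap.comp_apply,
      hx k _ (Nat.lt_succ_self k), map_zero, zero_add]

/-- If a condition on `x`, unchanged by adding boundaries, forces the first nonzero component of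
`x` to be a boundary in its column, then `x` is a boundary. -/
theorem mem_range_dK_of_forall (u : ι → R) (s n : ℕ) (N : Submodule R (K R ι s n))
    (hN : LinearMap.range (dK u s n) ≤ N)
    (h : ∀ k (hk : k < s), ∀ x ∈ N, (∀ j (hj : j < s), j < k → comp R ι s n j hj x = 0) →
      ∃ y, dQ u k n y = comp R ι s n k hk x) : N ≤ LinearMap.range (dK u s n) := by
  have key : ∀ t k, k + t = s → ∀ x ∈ N, (∀ j (hj : j < s), j < k → comp R ι s n j hj x = 0) →
      x ∈ LinearMap.range (dK u s n) := by
    intro t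
    induction t with
    | zero =>
      intro k hk x _ hx
      rw [K_ext (y := 0) fun j hj => hx j hj (by omega)]
      exact Submodule.zero_mem _
    | succ t ih =>
      intro k hk x hxN hx
      have hks : k < s := by omega
      obtain ⟨y, hy⟩ := h k hks x hxN hx
      have hmem : dK u s n (inclK R ι s (n + 1) ⟨k, hks⟩ y) ∈ LinearMap.range (dK u s n) := ⟨_, rfl⟩
      -- The differential never lowers the column, so this correction clears column `k` without
      -- disturbing earlier ones.
      rw [← sub_add_cancel x (dK u s n (inclK R ι s (n + 1) ⟨k, hks⟩ y))]
      refine Submodule.add_mem _ (ih (k + 1) (by omega) _ (Submodule.sub_mem _ hxN (hN hmem))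
        fun j hj hjk => ?_) hmem
      rw [map_sub, comp_dK]
      rcases (Nat.lt_succ_iff_lt_or_eq).mp hjk with hlt | rfl
      · rw [dKcomp_inclK_of_lt u hks hj hlt, hx j hj hlt, sub_zero]
      · rw [dKcomp_inclK_self, hy, sub_self]
  exact fun x hx => key s 0 (by omega) x hx fun j _ hj => absurd hj (Nat.not_lt_zero j)

theorem dK_exact {u : ι → R} (hu : IsRegularSeq u) (s n : ℕ) :
    Function.Exact (dK u s (n + 1)) (dK u s n) := by
  refine LinearMap.exact_iff.mpr (le_antisymm ?_ ?_)
  · refine mem_range_dK_of_forall u s (n + 1) _ ?_ fun k hk x hx hxk => ?_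
    · rintro _ ⟨y, rfl⟩
      exact LinearMap.congr_fun (dK_dK u s n) y
    · have h := comp_dK u s n k hk x
      rw [LinearMap.mem_ker.mp hx, map_zero, dKcomp_of_comp_eq_zero u hk hxk] at h
      exact (dQ_exact hu k n _).mp h.symm
  · rintro _ ⟨y, rfl⟩
    exact LinearMap.congr_fun (dK_dK u s n) y

/-- If `x_k` is the first component that may be nonzero, the later ones have values in `I^(k+1)`, as
does the total because `k + 1 ≤ s`. So the value of `x_k` lies in `I^(k+1)`, and exactness of
`Q^(k)` makes it a boundary. -/
theorem augK_exact {u : ι → R} (hu : IsRegularSeq u) (s : ℕ) :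
    Function.Exact (dK u s 0) (augK u s) := by
  refine LinearMap.exact_iff.mpr (le_antisymm ?_ ?_)
  · refine mem_range_dK_of_forall u s 0 _ ?_ fun k hk x hx hxk => ?_
    · rintro _ ⟨y, rfl⟩
      exact LinearMap.congr_fun (augK_dK u s) y
    · refine (augQ_exact hu k _).mp ((augQ_eq_zero_iff u k _).mpr ?_)
      rw [LinearMap.mem_ker, augK_apply, Submodule.mkQ_apply, Submodule.Quotient.mk_eq_zero,
        ← Finset.add_sum_erase _ _ (Finset.mem_univ (⟨k, hk⟩ : Fin s))] at hx
      have h1 := Ideal.pow_le_pow_right (I := idl u) (Nat.succ_le_of_lt hk) hx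
      rw [Ideal.add_mem_iff_left] at h1
      · have h2 := Ideal.mul_mem_left _ ((-1 : R) ^ k) h1
        rwa [← mul_assoc, ← mul_pow, neg_one_mul, neg_neg, one_pow, one_mul] at h2
      · refine Submodule.sum_mem _ fun j hj => Ideal.mul_mem_left _ _ ?_
        obtain ⟨j, hjs⟩ := j
        rcases lt_trichotomy j k with hlt | heq | hgt
        · rw [hxk j hjs hlt, map_zero]
          exact Submodule.zero_mem _
        · exact absurd (Fin.ext heq) (Finset.ne_of_mem_erase hj)
        · exact Ideal.pow_le_pow_right (Nat.succ_le_of_lt hgt) (evQ_mem u j _)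
  · rintro _ ⟨y, rfl⟩
    exact LinearMap.congr_fun (augK_dK u s) y

theorem augK_surjective (u : ι → R) {s : ℕ} (hs : s ≠ 0) : Function.Surjective (augK u s) := by
  intro y
  obtain ⟨r, rfl⟩ := Submodule.Quotient.mk_surjective _ y
  obtain ⟨x, rfl⟩ := idl_pow_le_range_evQ u 0 (show r ∈ idl u ^ 0 by simp)
  refine ⟨inclK R ι s 0 ⟨0, Nat.pos_of_ne_zero hs⟩ x, ?_⟩
  rw [augK_apply, Finset.sum_eq_single_of_mem ⟨0, Nat.pos_of_ne_zero hs⟩ (Finset.mem_univ _)]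
  · rw [comp_inclK_self, pow_zero, one_mul]
    rfl
  · intro j _ hj
    rw [comp_inclK_of_ne _ _ _ _ (fun h => hj (Fin.ext h)), map_zero, mul_zero]

theorem quasiIso_KAug {u : ι → R} (hu : IsRegularSeq u) {s : ℕ} (hs : s ≠ 0) :
    QuasiIso (KAug u s) := by
  refine quasiIso_toSingle₀ _ _ (augK_surjective u hs) ?_ fun n => ?_
  · rw [KComplex_d u s 0]
    exact augK_exact hu s
  · rw [KComplex_d u s n, KComplex_d u s (n + 1)]
    exact dK_exact hu s n

end

section

variable {R : Type u} [CommRing R]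

/-! ### Homology classes and their representatives -/

section IsClass

variable {C D : ChainComplex (ModuleCat.{u} R) ℕ} {n : ℕ}

theorem next_eq_pred (n : ℕ) : (ComplexShape.down ℕ).next n = n - 1 := by cases n <;> simp

theorem exists_isClass_left (x : C.homology n) : ∃ a, IsClass C n a x := by
  obtain ⟨c, hc⟩ := (ModuleCat.epi_iff_surjective (C.homologyπ n)).mp inferInstance x
  exact ⟨_, c, rfl, hc⟩

/-- For `n = 0` the truncated index gives the zero map `d 0 0`, so the condition is void. -/
theorem exists_isClass_right {a : C.X n} (ha : (C.d n (n - 1)).hom a = 0) :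
    ∃ x, IsClass C n a x := by
  let K := LinearMap.ker (C.d n (n - 1)).hom
  have hK : ModuleCat.ofHom K.subtype ≫ C.d n (n - 1) = 0 :=
    ModuleCat.hom_ext (LinearMap.ext fun y => y.2)
  have h := C.liftCycles_i (ModuleCat.ofHom K.subtype) (n - 1) (next_eq_pred n) hK
  exact ⟨_, (C.liftCycles (ModuleCat.ofHom K.subtype) (n - 1) (next_eq_pred n) hK).hom ⟨a, ha⟩,
    LinearMap.congr_fun (congrArg ModuleCat.Hom.hom h) ⟨a, ha⟩, rfl⟩

namespace IsClass

variable {a a' : C.X n} {x x' : C.homology n}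

theorem d_eq_zero (h : IsClass C n a x) (j : ℕ) : (C.d n j).hom a = 0 := by
  obtain ⟨c, rfl, -⟩ := h
  exact LinearMap.congr_fun (congrArg ModuleCat.Hom.hom (C.iCycles_d n j)) c

theorem sub (h : IsClass C n a x) (h' : IsClass C n a' x') : IsClass C n (a - a') (x - x') := by
  obtain ⟨c, rfl, rfl⟩ := h
  obtain ⟨c', rfl, rfl⟩ := h'
  exact ⟨c - c', map_sub _ _ _, map_sub _ _ _⟩

/-- Homology is the cokernel of the map into cycles, and cycles embed in the chain module. -/
theorem eq_zero_iff (h : IsClass C n a x) : x = 0 ↔ ∃ w, (C.d (n + 1) n).hom w = a := by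
  have hex : (ShortComplex.mk (C.toCycles (n + 1) n) (C.homologyπ n) (by simp)).Exact :=
    ShortComplex.exact_of_g_is_cokernel _ (C.homologyIsCokernel (n + 1) n (by simp))
  have hex' := (ShortComplex.ShortExact.moduleCat_exact_iff_function_exact _).mp hex
  have hinj := (ModuleCat.mono_iff_injective (C.iCycles n)).mp inferInstance
  have hi : ∀ w, (C.iCycles n).hom ((C.toCycles (n + 1) n).hom w) = (C.d (n + 1) n).hom w :=
    fun w => LinearMap.congr_fun (congrArg ModuleCat.Hom.hom (C.toCycles_i (n + 1) n)) w
  obtain ⟨c, rfl, rfl⟩ := h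
  refine (hex' c).trans (exists_congr fun w => ?_)
  rw [← hi]
  exact hinj.eq_iff.symm

theorem eq_iff (h : IsClass C n a x) (h' : IsClass C n a' x') :
    x = x' ↔ ∃ w, (C.d (n + 1) n).hom w = a - a' := by
  rw [← sub_eq_zero, (h.sub h').eq_zero_iff]

theorem unique (h : IsClass C n a x) (h' : IsClass C n a x') : x = x' :=
  (h.eq_iff h').mpr ⟨0, by rw [map_zero, sub_self]⟩

theorem map (f : C ⟶ D) (h : IsClass C n a x) :
    IsClass D n ((f.f n).hom a) ((HomologicalComplex.homologyMap f n).hom x) := by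
  obtain ⟨c, rfl, rfl⟩ := h
  refine ⟨(HomologicalComplex.cyclesMap f n).hom c, ?_, ?_⟩
  · exact LinearMap.congr_fun
      (congrArg ModuleCat.Hom.hom (HomologicalComplex.cyclesMap_i f n)) c
  · exact (LinearMap.congr_fun
      (congrArg ModuleCat.Hom.hom (HomologicalComplex.homologyπ_naturality f n)) c).symm

theorem degHom {f : ∀ n, C.X (n + 1) ⟶ D.X n}
    (hf : ∀ n, f (n + 1) ≫ D.d (n + 1) n = -(C.d (n + 2) (n + 1) ≫ f n)) {a : C.X (n + 1)}
    {x : C.homology (n + 1)} (h : IsClass C (n + 1) a x) :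
    IsClass D n ((f n).hom a) ((degHom f hf n).hom x) := by
  obtain ⟨c, rfl, rfl⟩ := h
  have h0 : (C.iCycles (n + 1) ≫ f n) ≫ D.d n (n - 1) = 0 := by
    cases n with
    | zero => rw [D.shape _ _ (by simp), Limits.comp_zero]
    | succ n =>
      change (C.iCycles (n + 2) ≫ f (n + 1)) ≫ D.d (n + 1) n = 0
      rw [Category.assoc, hf, Preadditive.comp_neg, ← Category.assoc, C.iCycles_d,
        Limits.zero_comp, neg_zero]
  have hπ : C.homologyπ (n + 1) ≫ RegularQuotient.degHom f hf n =
      D.liftCycles (C.iCycles (n + 1) ≫ f n) (n - 1) (next_eq_pred n) h0 ≫ D.homologyπ n :=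
    (C.homologyIsCokernel (n + 2) (n + 1) (by simp)).fac _ Limits.WalkingParallelPair.one
  have hi := D.liftCycles_i (C.iCycles (n + 1) ≫ f n) (n - 1) (next_eq_pred n) h0
  exact ⟨_, LinearMap.congr_fun (congrArg ModuleCat.Hom.hom hi) c,
    (LinearMap.congr_fun (congrArg ModuleCat.Hom.hom hπ) c).symm⟩

end IsClass

theorem isClass_d (w : C.X (n + 1)) : IsClass C n ((C.d (n + 1) n).hom w) 0 := by
  obtain ⟨x, hx⟩ := exists_isClass_right (a := (C.d (n + 1) n).hom w)
    (LinearMap.congr_fun (congrArg ModuleCat.Hom.hom (C.d_comp_d (n + 1) n (n - 1))) w)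
  have h0 := hx.eq_zero_iff.mpr ⟨w, rfl⟩
  rwa [h0] at hx

end IsClass

/-! ### Lifting along projective resolutions -/

/-- A map from a complex of projectives in degree zero which vanishes on boundaries lifts to a chain
map to a resolution. -/
theorem exists_lift {C : ChainComplex (ModuleCat.{u} R) ℕ} (hC : ∀ n, Projective (C.X n))
    {Z : ModuleCat.{u} R} (P : ProjectiveResolution Z) (ε : C.X 0 ⟶ Z) (hε : C.d 1 0 ≫ ε = 0) :
    ∃ f : C ⟶ P.complex, f.f 0 ≫ P.π.f 0 = ε := by
  have := hC
  have hP : Epi (P.π.f 0) := inferInstance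
  let f0 : C.X 0 ⟶ P.complex.X 0 := @Projective.factorThru _ _ _ _ _ (hC 0) ε (P.π.f 0) hP
  have hf0 : f0 ≫ P.π.f 0 = ε := @Projective.factorThru_comp _ _ _ _ _ (hC 0) ε (P.π.f 0) hP
  let f1 : C.X 1 ⟶ P.complex.X 1 := P.exact₀.liftFromProjective (C.d 1 0 ≫ f0) (by
    change (C.d 1 0 ≫ f0) ≫ P.π.f 0 = 0
    rw [Category.assoc, hf0]
    exact hε)
  have hf1 : f1 ≫ P.complex.d 1 0 = C.d 1 0 ≫ f0 := P.exact₀.liftFromProjective_comp _ _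
  refine ⟨ChainComplex.mkHom _ _ f0 f1 hf1 fun n ⟨g, g', w⟩ =>
    ⟨(P.exact_succ n).liftFromProjective (C.d (n + 2) (n + 1) ≫ g') (by simp [w]),
      (P.exact_succ n).liftFromProjective_comp _ _⟩, ?_⟩
  rw [ChainComplex.mkHom_f_0, hf0]

/-- A chain map from a complex of projectives to a resolution which is zero on augmentations is
null-homotopic. -/
theorem nonempty_homotopy_zero {C : ChainComplex (ModuleCat.{u} R) ℕ}
    (hC : ∀ n, Projective (C.X n)) {Z : ModuleCat.{u} R} (P : ProjectiveResolution Z)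
    (f : C ⟶ P.complex) (hf : f.f 0 ≫ P.π.f 0 = 0) : Nonempty (Homotopy f 0) := by
  have := hC
  let h0 : C.X 0 ⟶ P.complex.X 1 := P.exact₀.liftFromProjective (f.f 0) hf
  have hh0 : h0 ≫ P.complex.d 1 0 = f.f 0 := P.exact₀.liftFromProjective_comp _ _
  let h1 : C.X 1 ⟶ P.complex.X 2 :=
    (P.exact_succ 0).liftFromProjective (f.f 1 - C.d 1 0 ≫ h0) (by
      simp [Preadditive.sub_comp, hh0])
  have hh1 : h1 ≫ P.complex.d 2 1 = f.f 1 - C.d 1 0 ≫ h0 :=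
    (P.exact_succ 0).liftFromProjective_comp _ _
  exact ⟨Homotopy.mkInductive _ h0 hh0.symm h1 (by rw [hh1]; abel) fun n ⟨g, g', w⟩ =>
    ⟨(P.exact_succ (n + 1)).liftFromProjective (f.f (n + 2) - C.d _ _ ≫ g') (by simp [w]), by
      rw [(P.exact_succ (n + 1)).liftFromProjective_comp]
      abel⟩⟩

end

section

variable {R : Type u} [CommRing R]

/-! ### Tensor products of chain complexes -/

section TensorComplex

variable (X Y : ChainComplex (ModuleCat.{u} R) ℕ)

/-- The tensor product of two chain complexes. -/
abbrev tot : ChainComplex (ModuleCat.{u} R) ℕ := HomologicalComplex.tensorObj X Y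

/-- The element `x ⊗ y` of the tensor product of two complexes. -/
def tmulTot {m n k : ℕ} (h : m + n = k) : X.X m →ₗ[R] Y.X n →ₗ[R] (tot X Y).X k :=
  (TensorProduct.mk R (X.X m) (Y.X n)).compr₂ (HomologicalComplex.ιTensorObj X Y m n k h).hom

/-- When one factor has degree zero the Leibniz rule loses a term; the two lemmas that follow treat
those cases. -/
theorem d_tmulTot_succ_succ (m n k : ℕ) (h : m + n = k) (x : X.X (m + 1)) (y : Y.X (n + 1)) :
    ((tot X Y).d (k + 2) (k + 1)).hom (tmulTot X Y (by omega) x y) =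
      tmulTot X Y (by omega) ((X.d (m + 1) m).hom x) y +
      (-1 : R) ^ (m + 1) • tmulTot X Y (by omega) x ((Y.d (n + 1) n).hom y) := by
  have key : HomologicalComplex.ιTensorObj X Y (m + 1) (n + 1) (k + 2) (by omega) ≫
      (tot X Y).d (k + 2) (k + 1) =
      X.d (m + 1) m ▷ Y.X (n + 1) ≫
        HomologicalComplex.ιTensorObj X Y m (n + 1) (k + 1) (by omega) +
      (-1 : ℤˣ) ^ (m + 1) • (X.X (m + 1) ◁ Y.d (n + 1) n ≫
        HomologicalComplex.ιTensorObj X Y (m + 1) n (k + 1) (by omega)) := by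
    rw [HomologicalComplex.mapBifunctor.d_eq, Preadditive.comp_add,
      HomologicalComplex.mapBifunctor.ι_D₁, HomologicalComplex.mapBifunctor.ι_D₂,
      HomologicalComplex.mapBifunctor.d₁_eq _ _ _ _ (i₁' := m) (by simp) _ _
        (show m + (n + 1) = k + 1 by omega),
      HomologicalComplex.mapBifunctor.d₂_eq _ _ _ _ _ (i₂' := n) (by simp) _
        (show (m + 1) + n = k + 1 by omega)]
    simp
  -- The total complex carries its sign as an integer unit; splitting by parity turns it into a
  -- scalar of `R`.
  rcases Nat.even_or_odd (m + 1) with hm | hm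
  · rw [hm.neg_one_pow, one_smul] at key
    rw [hm.neg_one_pow, one_smul]
    exact LinearMap.congr_fun (congrArg ModuleCat.Hom.hom key) (x ⊗ₜ y)
  · rw [hm.neg_one_pow, Units.neg_smul, one_smul] at key
    rw [hm.neg_one_pow, neg_one_smul]
    exact LinearMap.congr_fun (congrArg ModuleCat.Hom.hom key) (x ⊗ₜ y)

theorem d_tmulTot_zero_succ (n : ℕ) (x : X.X 0) (y : Y.X (n + 1)) :
    ((tot X Y).d (n + 1) n).hom (tmulTot X Y (by omega) x y) =
      tmulTot X Y (by omega) x ((Y.d (n + 1) n).hom y) := by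
  have key : HomologicalComplex.ιTensorObj X Y 0 (n + 1) (n + 1) (by omega) ≫
      (tot X Y).d (n + 1) n =
      X.X 0 ◁ Y.d (n + 1) n ≫
        HomologicalComplex.ιTensorObj X Y 0 n n (by omega) := by
    rw [HomologicalComplex.mapBifunctor.d_eq, Preadditive.comp_add,
      HomologicalComplex.mapBifunctor.ι_D₁, HomologicalComplex.mapBifunctor.ι_D₂,
      HomologicalComplex.mapBifunctor.d₁_eq_zero _ _ _ _ _ _ _ (by simp),
      HomologicalComplex.mapBifunctor.d₂_eq _ _ _ _ _ (i₂' := n) (by simp) _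
        (show 0 + n = n by omega)]
    simp
  exact LinearMap.congr_fun (congrArg ModuleCat.Hom.hom key) (x ⊗ₜ y)

theorem d_tmulTot_succ_zero (m : ℕ) (x : X.X (m + 1)) (y : Y.X 0) :
    ((tot X Y).d (m + 1) m).hom (tmulTot X Y (by omega) x y) =
      tmulTot X Y (by omega) ((X.d (m + 1) m).hom x) y := by
  have key : HomologicalComplex.ιTensorObj X Y (m + 1) 0 (m + 1) (by omega) ≫
      (tot X Y).d (m + 1) m =
      X.d (m + 1) m ▷ Y.X 0 ≫
        HomologicalComplex.ιTensorObj X Y m 0 m (by omega) := by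
    rw [HomologicalComplex.mapBifunctor.d_eq, Preadditive.comp_add,
      HomologicalComplex.mapBifunctor.ι_D₁, HomologicalComplex.mapBifunctor.ι_D₂,
      HomologicalComplex.mapBifunctor.d₂_eq_zero _ _ _ _ _ _ _ (by simp),
      HomologicalComplex.mapBifunctor.d₁_eq _ _ _ _ (i₁' := m) (by simp) _ _
        (show m + 0 = m by omega)]
    simp
  exact LinearMap.congr_fun (congrArg ModuleCat.Hom.hom key) (x ⊗ₜ y)

variable {X Y}

/-- A lifting problem out of the direct sum is solved summand by summand, each `X_m ⊗ Y_n` being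
projective. -/
theorem projective_tot (hX : ∀ n, Projective (X.X n)) (hY : ∀ n, Projective (Y.X n)) (k : ℕ) :
    Projective ((tot X Y).X k) where
  factors {E M} f e he := by
    have hproj : ∀ m n, Projective (X.X m ⊗ Y.X n) := fun m n => by
      have h1 := (IsProjective.iff_projective (X.X m)).mpr (hX m)
      have h2 := (IsProjective.iff_projective (Y.X n)).mpr (hY n)
      exact (IsProjective.iff_projective (TensorProduct R (X.X m) (Y.X n))).mp inferInstance
    refine ⟨HomologicalComplex.mapBifunctorDesc fun m n h =>
      @Projective.factorThru _ _ _ _ _ (hproj m n)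
        (HomologicalComplex.ιTensorObj X Y m n k h ≫ f) e he, ?_⟩
    refine HomologicalComplex.mapBifunctor.hom_ext fun m n h => ?_
    rw [HomologicalComplex.ι_mapBifunctorDesc_assoc]
    exact @Projective.factorThru_comp _ _ _ _ _ (hproj m n) _ e he

theorem tot_hom_ext {k : ℕ} {M : ModuleCat.{u} R} {f g : (tot X Y).X k ⟶ M}
    (h : ∀ m n (h : m + n = k) x y, f.hom (tmulTot X Y h x y) = g.hom (tmulTot X Y h x y)) :
    f = g :=
  HomologicalComplex.mapBifunctor.hom_ext fun m n hmn =>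
    ModuleCat.hom_ext (TensorProduct.ext' (h m n hmn))

/-- A map out of a term of the tensor product of two complexes, from bilinear maps. -/
def totDesc {k : ℕ} {M : ModuleCat.{u} R} (f : ∀ m n, m + n = k → (X.X m →ₗ[R] Y.X n →ₗ[R] M)) :
    (tot X Y).X k ⟶ M :=
  HomologicalComplex.mapBifunctorDesc fun m n h => ModuleCat.ofHom (TensorProduct.lift (f m n h))

theorem totDesc_tmulTot {k : ℕ} {M : ModuleCat.{u} R}
    (f : ∀ m n, m + n = k → (X.X m →ₗ[R] Y.X n →ₗ[R] M)) {m n : ℕ} (h : m + n = k) (x : X.X m)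
    (y : Y.X n) : (totDesc f).hom (tmulTot X Y h x y) = f m n h x y := by
  have := HomologicalComplex.ι_mapBifunctorDesc (K₁ := X) (K₂ := Y)
    (F := curriedTensor (ModuleCat.{u} R)) (c := ComplexShape.down ℕ)
    (fun m n h => ModuleCat.ofHom (TensorProduct.lift (f m n h))) m n h
  exact LinearMap.congr_fun (congrArg ModuleCat.Hom.hom this) (x ⊗ₜ y)

/-- The tensor product of two chain maps. -/
abbrev totMap {X' Y' : ChainComplex (ModuleCat.{u} R) ℕ} (f : X ⟶ X') (g : Y ⟶ Y') :
    tot X Y ⟶ tot X' Y' :=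
  HomologicalComplex.tensorHom f g

theorem totMap_tmulTot {X' Y' : ChainComplex (ModuleCat.{u} R) ℕ} (f : X ⟶ X') (g : Y ⟶ Y')
    {m n k : ℕ} (h : m + n = k) (x : X.X m) (y : Y.X n) :
    ((totMap f g).f k).hom (tmulTot X Y h x y) =
      tmulTot X' Y' h ((f.f m).hom x) ((g.f n).hom y) :=
  LinearMap.congr_fun (congrArg ModuleCat.Hom.hom
    (HomologicalComplex.ι_mapBifunctorMap f g (curriedTensor (ModuleCat.{u} R))
      (ComplexShape.down ℕ) m n k h)) (x ⊗ₜ y)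

/-! ### The external product -/

variable (X Y) (A : Type u) [CommRing A] [Algebra R A]

/-- The external product `(a ⊗ x, b ⊗ y) ↦ a b ⊗ (x ⊗ y)`. -/
def cross {m n k : ℕ} (h : m + n = k) :
    (tensC A X).X m →ₗ[R] (tensC A Y).X n →ₗ[R] (tensC A (tot X Y)).X k :=
  TensorProduct.map₂ (LinearMap.mul R A) (tmulTot X Y h)

variable {X Y A}

theorem tensor_bilin_ext {V W M : Type*} [AddCommGroup V] [Module R V] [AddCommGroup W]
    [Module R W] [AddCommGroup M] [Module R M] {B B' : A ⊗[R] V →ₗ[R] A ⊗[R] W →ₗ[R] M}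
    (h : ∀ a x b y, B (a ⊗ₜ x) (b ⊗ₜ y) = B' (a ⊗ₜ x) (b ⊗ₜ y)) (s : A ⊗[R] V) (t : A ⊗[R] W) :
    B s t = B' s t := by
  have : B = B' := TensorProduct.ext' fun a x => TensorProduct.ext' (h a x)
  rw [this]

theorem d_cross_succ_succ (m n k : ℕ) (h : m + n = k) (a : (tensC A X).X (m + 1))
    (b : (tensC A Y).X (n + 1)) :
    ((tensC A (tot X Y)).d (k + 2) (k + 1)).hom (cross X Y A (by omega) a b) =
      cross X Y A (by omega) (((tensC A X).d (m + 1) m).hom a) b +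
      (-1 : R) ^ (m + 1) • cross X Y A (by omega) a (((tensC A Y).d (n + 1) n).hom b) := by
  refine tensor_bilin_ext
    (B := (TensorProduct.map₂ (LinearMap.mul R A) (tmulTot X Y (by omega))).compr₂ (((tot X Y).d (k + 2) (k + 1)).hom.lTensor A))
    (B' := (TensorProduct.map₂ (LinearMap.mul R A) (tmulTot X Y (by omega))).comp ((X.d (m + 1) m).hom.lTensor A) +
      (-1 : R) ^ (m + 1) • (TensorProduct.map₂ (LinearMap.mul R A) (tmulTot X Y (by omega))).compl₂ ((Y.d (n + 1) n).hom.lTensor A))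
    (fun a x b y => ?_) a b
  refine (congrArg (fun z => (a * b) ⊗ₜ[R] z) (d_tmulTot_succ_succ X Y m n k h x y)).trans ?_
  simp only [TensorProduct.tmul_add, TensorProduct.tmul_smul]
  rfl

theorem d_cross_zero_succ (n : ℕ) (a : (tensC A X).X 0) (b : (tensC A Y).X (n + 1)) :
    ((tensC A (tot X Y)).d (n + 1) n).hom (cross X Y A (by omega) a b) =
      cross X Y A (by omega) a (((tensC A Y).d (n + 1) n).hom b) :=
  tensor_bilin_ext
    (B := (TensorProduct.map₂ (LinearMap.mul R A) (tmulTot X Y (by omega))).compr₂ (((tot X Y).d (n + 1) n).hom.lTensor A))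
    (B' := (TensorProduct.map₂ (LinearMap.mul R A) (tmulTot X Y (by omega))).compl₂ ((Y.d (n + 1) n).hom.lTensor A))
    (fun a x b y => congrArg (fun z => (a * b) ⊗ₜ[R] z) (d_tmulTot_zero_succ X Y n x y)) a b

theorem d_cross_succ_zero (m : ℕ) (a : (tensC A X).X (m + 1)) (b : (tensC A Y).X 0) :
    ((tensC A (tot X Y)).d (m + 1) m).hom (cross X Y A (by omega) a b) =
      cross X Y A (by omega) (((tensC A X).d (m + 1) m).hom a) b :=
  tensor_bilin_ext
    (B := (TensorProduct.map₂ (LinearMap.mul R A) (tmulTot X Y (by omega))).compr₂ (((tot X Y).d (m + 1) m).hom.lTensor A))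
    (B' := (TensorProduct.map₂ (LinearMap.mul R A) (tmulTot X Y (by omega))).comp ((X.d (m + 1) m).hom.lTensor A))
    (fun a x b y => congrArg (fun z => (a * b) ⊗ₜ[R] z) (d_tmulTot_succ_zero X Y m x y)) a b

theorem cross_map {X' Y' : ChainComplex (ModuleCat.{u} R) ℕ} (f : X ⟶ X') (g : Y ⟶ Y')
    {m n k : ℕ} (h : m + n = k) (a : (tensC A X).X m) (b : (tensC A Y).X n) :
    ((tens R A).map ((totMap f g).f k)).hom (cross X Y A h a b) =
      cross X' Y' A h (((tens R A).map (f.f m)).hom a) (((tens R A).map (g.f n)).hom b) :=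
  tensor_bilin_ext
    (B := (TensorProduct.map₂ (LinearMap.mul R A) (tmulTot X Y h)).compr₂ (((totMap f g).f k).hom.lTensor A))
    (B' := (TensorProduct.map₂ (LinearMap.mul R A) (tmulTot X' Y' h)).compl₁₂ ((f.f m).hom.lTensor A) ((g.f n).hom.lTensor A))
    (fun a x b y => congrArg (fun z => (a * b) ⊗ₜ[R] z) (totMap_tmulTot f g h x y)) a b

theorem d_cross_eq_zero {m n k : ℕ} (h : m + n = k) {a : (tensC A X).X m} {b : (tensC A Y).X n}
    (ha : ∀ j, ((tensC A X).d m j).hom a = 0) (hb : ∀ j, ((tensC A Y).d n j).hom b = 0) (j : ℕ) :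
    ((tensC A (tot X Y)).d k j).hom (cross X Y A h a b) = 0 := by
  by_cases hj : j + 1 = k
  · subst hj
    match m, n with
    | 0, 0 => omega
    | 0, n + 1 =>
      obtain rfl : n = j := by omega
      rw [d_cross_zero_succ n a b, hb, map_zero]
    | m + 1, 0 =>
      obtain rfl : m = j := by omega
      rw [d_cross_succ_zero m a b, ha, map_zero, LinearMap.zero_apply]
    | m + 1, n + 1 =>
      obtain ⟨k, rfl⟩ : ∃ k, j = k + 1 := ⟨m + n, by omega⟩
      rw [d_cross_succ_succ m n k (by omega) a b, ha, hb, map_zero, map_zero,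
        LinearMap.zero_apply, smul_zero, add_zero]
  · rw [(tensC A (tot X Y)).shape k j hj]
    rfl

/-- The external product of `w` and `b` is the required chain: the other Leibniz term contains `db =
0`. -/
theorem cross_d_left {m n k : ℕ} (h : m + n = k) (w : (tensC A X).X (m + 1)) {b : (tensC A Y).X n}
    (hb : ∀ j, ((tensC A Y).d n j).hom b = 0) :
    ∃ v, ((tensC A (tot X Y)).d (k + 1) k).hom v =
      cross X Y A h (((tensC A X).d (m + 1) m).hom w) b := by
  match n with
  | 0 =>
    obtain rfl : m = k := h
    exact ⟨_, d_cross_succ_zero m w b⟩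
  | n + 1 =>
    obtain ⟨k, rfl⟩ : ∃ k', k = k' + 1 := ⟨m + n, by omega⟩
    refine ⟨_, (d_cross_succ_succ m n k (by omega) w b).trans ?_⟩
    rw [hb, map_zero, smul_zero, add_zero]

theorem cross_d_right {m n k : ℕ} (h : m + n = k) {a : (tensC A X).X m} (w : (tensC A Y).X (n + 1))
    (ha : ∀ j, ((tensC A X).d m j).hom a = 0) :
    ∃ v, ((tensC A (tot X Y)).d (k + 1) k).hom v =
      cross X Y A h a (((tensC A Y).d (n + 1) n).hom w) := by
  match m with
  | 0 =>
    obtain rfl : n = k := by omega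
    exact ⟨_, d_cross_zero_succ n a w⟩
  | m + 1 =>
    obtain ⟨k, rfl⟩ : ∃ k', k = k' + 1 := ⟨m + n, by omega⟩
    -- The sign cancels the one that the Leibniz rule puts on the second factor.
    refine ⟨(-1 : R) ^ (m + 1) • cross X Y A (by omega) a w, ?_⟩
    rw [map_smul]
    refine (congrArg _ (d_cross_succ_succ m n k (by omega) a w)).trans ?_
    rw [ha, map_zero, LinearMap.zero_apply, zero_add, smul_smul, ← mul_pow, neg_one_mul, neg_neg,
      one_pow, one_smul]

/-- The homology class of an external product depends only on the homology classes of the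
factors. -/
theorem isClass_cross {m n k : ℕ} (h : m + n = k) {a a' : (tensC A X).X m} {b b' : (tensC A Y).X n}
    {x : (tensC A X).homology m} {y : (tensC A Y).homology n}
    (ha : IsClass (tensC A X) m a x) (ha' : IsClass (tensC A X) m a' x)
    (hb : IsClass (tensC A Y) n b y) (hb' : IsClass (tensC A Y) n b' y) :
    ∃ z, IsClass (tensC A (tot X Y)) k (cross X Y A h a b) z ∧
      IsClass (tensC A (tot X Y)) k (cross X Y A h a' b') z := by
  obtain ⟨z, hz⟩ := exists_isClass_right (d_cross_eq_zero h ha.d_eq_zero hb.d_eq_zero (k - 1))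
  obtain ⟨z', hz'⟩ := exists_isClass_right (d_cross_eq_zero h ha'.d_eq_zero hb'.d_eq_zero (k - 1))
  refine ⟨z, hz, ?_⟩
  obtain ⟨w, hw⟩ := (ha.eq_iff ha').mp rfl
  obtain ⟨w', hw'⟩ := (hb.eq_iff hb').mp rfl
  obtain ⟨v, hv⟩ := cross_d_left h w hb.d_eq_zero
  obtain ⟨v', hv'⟩ := cross_d_right h w' ha'.d_eq_zero
  -- One factor is changed at a time: `a × b - a' × b' = (a - a') × b + a' × (b - b')`.
  have hzz : z = z' := (hz.eq_iff hz').mpr ⟨v + v', by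
    rw [map_add, hv, hv', hw, hw', map_sub, map_sub, LinearMap.sub_apply, sub_add_sub_cancel]⟩
  rwa [hzz]

end TensorComplex

/-! ### Pairings of resolutions -/

section Pairing

variable {A B : Type u} [CommRing A] [Algebra R A] [CommRing B] [Algebra R B]

/-- The augmentation of a resolution. -/
abbrev aug {M : Type u} [AddCommGroup M] [Module R M]
    (P : ProjectiveResolution (ModuleCat.of R M)) : P.complex.X 0 →ₗ[R] M :=
  (ChainComplex.toSingle₀Equiv _ _ P.π).1.hom

theorem aug_d {M : Type u} [AddCommGroup M] [Module R M]
    (P : ProjectiveResolution (ModuleCat.of R M)) (x : P.complex.X 1) :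
    aug P ((P.complex.d 1 0).hom x) = 0 :=
  LinearMap.congr_fun (congrArg ModuleCat.Hom.hom (ChainComplex.toSingle₀Equiv _ _ P.π).2) x

/-- The chain map `P ⊗ P → P` given by a pairing. -/
def pairingMap {P : ProjectiveResolution (ModuleCat.of R B)} (μ : ResPairing P) :
    tot P.complex P.complex ⟶ P.complex where
  f k := totDesc fun _ _ h => μ.mul h
  comm' i j hij := by
    obtain rfl : j + 1 = i := hij
    refine tot_hom_ext fun m n h x y => ?_
    rw [ModuleCat.hom_comp, ModuleCat.hom_comp, LinearMap.comp_apply, LinearMap.comp_apply,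
      totDesc_tmulTot]
    match m, n with
    | 0, 0 => omega
    | 0, n + 1 =>
      obtain rfl : n = j := by omega
      rw [d_tmulTot_zero_succ, totDesc_tmulTot]
      exact μ.leibniz_zero_left n x y
    | m + 1, 0 =>
      obtain rfl : m = j := by omega
      rw [d_tmulTot_succ_zero, totDesc_tmulTot]
      exact μ.leibniz_zero_right m x y
    | m + 1, n + 1 =>
      obtain ⟨k, rfl⟩ : ∃ k, j = k + 1 := ⟨m + n, by omega⟩
      rw [d_tmulTot_succ_succ _ _ m n k (by omega), map_add, map_smul, totDesc_tmulTot,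
        totDesc_tmulTot]
      exact μ.leibniz m n k (by omega) x y

theorem pairingMap_tmulTot {P : ProjectiveResolution (ModuleCat.of R B)} (μ : ResPairing P)
    {m n k : ℕ} (h : m + n = k) (x : P.complex.X m) (y : P.complex.X n) :
    ((pairingMap μ).f k).hom (tmulTot _ _ h x y) = μ.mul h x y :=
  totDesc_tmulTot (fun _ _ h => μ.mul h) h x y

/-- Factoring the product into an external product and a chain map `P ⊗ P → P` lets homotopies act
on the second step. -/
theorem tensMul_eq {P : ProjectiveResolution (ModuleCat.of R B)} (μ : ResPairing P) (m n : ℕ)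
    (a : (tensC A P.complex).X m) (b : (tensC A P.complex).X n) :
    tensMul P μ m n a b =
      ((tens R A).map ((pairingMap μ).f (m + n))).hom (cross P.complex P.complex A rfl a b) :=
  tensor_bilin_ext (B := tensMul P μ m n)
    (B' := (TensorProduct.map₂ (LinearMap.mul R A) (tmulTot P.complex P.complex rfl)).compr₂ (((pairingMap μ).f (m + n)).hom.lTensor A))
    (fun a x b y => congrArg (fun z => (a * b) ⊗ₜ[R] z) (pairingMap_tmulTot μ rfl x y).symm) a b

/-- `P ⊗ P` consists of projectives and the product of the two augmentations kills its boundaries,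
so it lifts to a chain map. -/
theorem exists_resPairing (P : ProjectiveResolution (ModuleCat.of R B)) :
    Nonempty (ResPairing P) := by
  -- Summands are indexed by all `m + n = 0`, so the factors are transported to index zero.
  let ε : (tot P.complex P.complex).X 0 ⟶ ModuleCat.of R B := totDesc fun m n h =>
    (LinearMap.mul R B).compl₁₂
      (aug P ∘ₗ (P.complex.XIsoOfEq (show m = 0 by omega)).hom.hom)
      (aug P ∘ₗ (P.complex.XIsoOfEq (show n = 0 by omega)).hom.hom)
  have hε : ∀ x y, ε.hom (tmulTot P.complex P.complex (zero_add 0) x y) = aug P x * aug P y :=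
    fun x y => (totDesc_tmulTot _ _ x y).trans (by
      simp)
  have hd : (tot P.complex P.complex).d 1 0 ≫ ε = 0 := by
    refine tot_hom_ext fun m n h x y => ?_
    rw [ModuleCat.hom_comp, LinearMap.comp_apply]
    rcases (by omega : m = 0 ∧ n = 1 ∨ m = 1 ∧ n = 0) with ⟨rfl, rfl⟩ | ⟨rfl, rfl⟩
    · rw [d_tmulTot_zero_succ _ _ 0 x y, hε, aug_d, mul_zero]
      rfl
    · rw [d_tmulTot_succ_zero _ _ 0 x y, hε, aug_d, zero_mul]
      rfl
  obtain ⟨F, hF⟩ := exists_lift (projective_tot P.projective P.projective) P ε hd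
  exact ⟨{
    mul := fun {m n k} h => (tmulTot P.complex P.complex h).compr₂ (F.f k).hom
    leibniz := fun m n k h x y => by
      have h1 := LinearMap.congr_fun (congrArg ModuleCat.Hom.hom (F.comm (k + 2) (k + 1)))
        (tmulTot P.complex P.complex (by omega : (m + 1) + (n + 1) = k + 2) x y)
      refine h1.trans ?_
      rw [ModuleCat.hom_comp, LinearMap.comp_apply, d_tmulTot_succ_succ _ _ m n k h, map_add,
        map_smul]
      rfl
    leibniz_zero_left := fun n x y => by
      have h1 := LinearMap.congr_fun (congrArg ModuleCat.Hom.hom (F.comm (n + 1) n))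
        (tmulTot P.complex P.complex (zero_add (n + 1)) x y)
      refine h1.trans ?_
      rw [ModuleCat.hom_comp, LinearMap.comp_apply, d_tmulTot_zero_succ]
      rfl
    leibniz_zero_right := fun m x y => by
      have h1 := LinearMap.congr_fun (congrArg ModuleCat.Hom.hom (F.comm (m + 1) m))
        (tmulTot P.complex P.complex (add_zero (m + 1)) x y)
      refine h1.trans ?_
      rw [ModuleCat.hom_comp, LinearMap.comp_apply, d_tmulTot_succ_zero]
      rfl
    aug := fun x y => by
      have h1 := LinearMap.congr_fun (congrArg ModuleCat.Hom.hom hF)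
        (tmulTot P.complex P.complex (zero_add 0) x y)
      exact h1.trans (hε x y) }⟩

end Pairing

end

section

variable {R : Type u} [CommRing R]

/-! ### Products in Tor -/

section TorProduct

/-- By naturality of the comparison, the induced map on Tor may be computed with any chain map over
`g`. -/
theorem isClass_torIso_map {A B B' : Type u} [AddCommGroup A] [Module R A] [AddCommGroup B]
    [Module R B] [AddCommGroup B'] [Module R B'] (g : B →ₗ[R] B')
    (P : ProjectiveResolution (ModuleCat.of R B)) (P' : ProjectiveResolution (ModuleCat.of R B'))
    (f : P.complex ⟶ P'.complex) (hf : f.f 0 ≫ P'.π.f 0 = P.π.f 0 ≫ ModuleCat.ofHom g)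
    {n : ℕ} {a : (tensC A P.complex).X n} {x : TorM R A B n}
    (h : IsClass (tensC A P.complex) n a ((torIso A P n).hom.hom x)) :
    IsClass (tensC A P'.complex) n (((tens R A).map (f.f n)).hom a)
      ((torIso A P' n).hom.hom (TorMap A g n x)) := by
  have h1 := ProjectiveResolution.isoLeftDerivedObj_hom_naturality (ModuleCat.ofHom g) P P' f hf
    (tens R A) n
  have h2 := LinearMap.congr_fun (congrArg ModuleCat.Hom.hom h1) x
  have h3 := h.map (((tens R A).mapHomologicalComplex _).map f)
  refine (congrArg (IsClass _ n _) h2).mpr h3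

theorem isClass_torIso_lift {A B : Type u} [AddCommGroup A] [Module R A] [AddCommGroup B]
    [Module R B] (P P' : ProjectiveResolution (ModuleCat.of R B))
    (f : P.complex ⟶ P'.complex) (hf : f.f 0 ≫ P'.π.f 0 = P.π.f 0)
    {n : ℕ} {a : (tensC A P.complex).X n} {x : TorM R A B n}
    (h : IsClass (tensC A P.complex) n a ((torIso A P n).hom.hom x)) :
    IsClass (tensC A P'.complex) n (((tens R A).map (f.f n)).hom a)
      ((torIso A P' n).hom.hom x) := by
  have h1 := isClass_torIso_map LinearMap.id P P' f
    (hf.trans (Category.comp_id (P.π.f 0)).symm) h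
  have h2 : TorMap A (LinearMap.id : B →ₗ[R] B) n = 𝟙 _ := CategoryTheory.Functor.map_id _ _
  rw [h2] at h1
  exact h1

theorem exists_isClass_torIso {A B : Type u} [AddCommGroup A] [Module R A] [AddCommGroup B]
    [Module R B] (P : ProjectiveResolution (ModuleCat.of R B)) {n : ℕ} {a : (tensC A P.complex).X n}
    {z : (tensC A P.complex).homology n} (h : IsClass (tensC A P.complex) n a z) :
    ∃ x, IsClass (tensC A P.complex) n a ((torIso A P n).hom.hom x) := by
  refine ⟨(torIso A P n).inv.hom z, ?_⟩
  have h1 := LinearMap.congr_fun (congrArg ModuleCat.Hom.hom (torIso A P n).inv_hom_id) z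
  exact (congrArg (IsClass _ n a) h1).mpr h

theorem torIso_injective {A B : Type u} [AddCommGroup A] [Module R A] [AddCommGroup B]
    [Module R B] (P : ProjectiveResolution (ModuleCat.of R B)) (n : ℕ) :
    Function.Injective (torIso A P n).hom.hom :=
  (ModuleCat.mono_iff_injective _).mp inferInstance

theorem isClass_of_homotopy {A : Type u} [AddCommGroup A] [Module R A]
    {T Z : ChainComplex (ModuleCat.{u} R) ℕ} {F G : T ⟶ Z} (h : Homotopy F G) {k : ℕ}
    {c : (tensC A T).X k} {z : (tensC A T).homology k} (hc : IsClass (tensC A T) k c z) :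
    ∃ w, IsClass (tensC A Z) k (((tens R A).map (F.f k)).hom c) w ∧
      IsClass (tensC A Z) k (((tens R A).map (G.f k)).hom c) w := by
  refine ⟨_, hc.map (((tens R A).mapHomologicalComplex _).map F), ?_⟩
  rw [((tens R A).mapHomotopy h).homologyMap_eq]
  exact hc.map (((tens R A).mapHomologicalComplex _).map G)

variable {A B : Type u} [CommRing A] [Algebra R A] [CommRing B] [Algebra R B]

theorem isClass_tensMul_iff {P : ProjectiveResolution (ModuleCat.of R B)} (μ : ResPairing P)
    {m n : ℕ} (a : (tensC A P.complex).X m) (b : (tensC A P.complex).X n)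
    (w : (tensC A P.complex).homology (m + n)) :
    IsClass (tensC A P.complex) (m + n) (tensMul P μ m n a b) w ↔
      IsClass (tensC A P.complex) (m + n)
        (((tens R A).map ((pairingMap μ).f (m + n))).hom (cross P.complex P.complex A rfl a b)) w :=
  iff_of_eq (congrArg (fun c => IsClass (tensC A P.complex) (m + n) c w) (tensMul_eq μ m n a b))

/-- Both composites lift the multiplication of `B`, so their difference lifts zero. -/
theorem nonempty_homotopy_pairing (P P' : ProjectiveResolution (ModuleCat.of R B))
    (μ : ResPairing P) (μ' : ResPairing P') (f : P.complex ⟶ P'.complex)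
    (hf : f.f 0 ≫ P'.π.f 0 = P.π.f 0) :
    Nonempty (Homotopy (pairingMap μ ≫ f) (totMap f f ≫ pairingMap μ')) := by
  refine (nonempty_homotopy_zero (projective_tot P.projective P.projective) P'
    (pairingMap μ ≫ f - totMap f f ≫ pairingMap μ') ?_).map fun h => Homotopy.equivSubZero.symm h
  refine tot_hom_ext fun m n h x y => ?_
  obtain ⟨rfl, rfl⟩ : m = 0 ∧ n = 0 := by omega
  have hf' : ∀ x, aug P' ((f.f 0).hom x) = aug P x :=
    fun x => LinearMap.congr_fun (congrArg ModuleCat.Hom.hom hf) x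
  have h1 : aug P' ((f.f 0).hom (((pairingMap μ).f 0).hom (tmulTot _ _ h x y))) =
      aug P x * aug P y := by
    rw [hf', pairingMap_tmulTot]
    exact μ.aug x y
  have h2 : aug P' (((pairingMap μ').f 0).hom (((totMap f f).f 0).hom (tmulTot _ _ h x y))) =
      aug P x * aug P y := by
    rw [totMap_tmulTot, pairingMap_tmulTot]
    exact (μ'.aug _ _).trans (by rw [← hf' x, ← hf' y])
  exact (map_sub (aug P') _ _).trans (sub_eq_zero.mpr (h1.trans h2.symm))

/-- The product of two elements of Tor is independent of all choices. -/
theorem IsTorProduct.unique {m n : ℕ} {x : TorM R A B m} {y : TorM R A B n}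
    {z z' : TorM R A B (m + n)} (h : IsTorProduct x y z) (h' : IsTorProduct x y z') : z = z' := by
  obtain ⟨P, μ, a, b, ha, hb, hz⟩ := h
  obtain ⟨P', μ', a', b', ha', hb', hz'⟩ := h'
  -- Both products are compared in `P'`, by a chain map over the identity of `B`.
  obtain ⟨f, hf⟩ := exists_lift P.projective P' (P.π.f 0) P.complex_d_comp_π_f_zero
  obtain ⟨w, hw⟩ := exists_isClass_right (d_cross_eq_zero (X := P.complex) (Y := P.complex) rfl
    ha.d_eq_zero hb.d_eq_zero _)
  obtain ⟨H⟩ := nonempty_homotopy_pairing P P' μ μ' f hf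
  obtain ⟨v, hv1, hv2⟩ := isClass_of_homotopy (A := A) H hw
  obtain ⟨v', hv1', hv2'⟩ := isClass_cross (X := P'.complex) (Y := P'.complex) rfl
    (isClass_torIso_lift P P' f hf ha) ha' (isClass_torIso_lift P P' f hf hb) hb'
  replace hz := (isClass_tensMul_iff μ a b _).mp hz
  replace hz' := (isClass_tensMul_iff μ' a' b' _).mp hz'
  have h1 := isClass_torIso_lift P P' f hf hz
  have h2 := hv1'.map (((tens R A).mapHomologicalComplex _).map (pairingMap μ'))
  have h3 := hv2'.map (((tens R A).mapHomologicalComplex _).map (pairingMap μ'))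
  refine torIso_injective P' (m + n) ?_
  have e1 : v = (torIso A P' (m + n)).hom.hom z := by
    refine hv1.unique ?_
    rw [HomologicalComplex.comp_f, Functor.map_comp]
    exact h1
  have e3 := h3.unique hz'
  rw [← e1, ← e3]
  refine hv2.unique ?_
  rw [HomologicalComplex.comp_f, Functor.map_comp]
  have hc := cross_map f f (A := A) (rfl : m + n = m + n) a b
  exact (congrArg (fun c => IsClass (tensC A P'.complex) (m + n)
    (((tens R A).map ((pairingMap μ').f (m + n))).hom c) _) hc).mpr h2

theorem existsUnique_isTorProduct {m n : ℕ} (x : TorM R A B m) (y : TorM R A B n) :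
    ∃! z, IsTorProduct x y z := by
  let P := projectiveResolution (ModuleCat.of R B)
  obtain ⟨μ⟩ := exists_resPairing P
  obtain ⟨a, ha⟩ := exists_isClass_left ((torIso A P m).hom.hom x)
  obtain ⟨b, hb⟩ := exists_isClass_left ((torIso A P n).hom.hom y)
  obtain ⟨w, hw, -⟩ := isClass_cross (X := P.complex) (Y := P.complex) rfl ha ha hb hb
  have h1 := hw.map (((tens R A).mapHomologicalComplex _).map (pairingMap μ))
  obtain ⟨z, hz⟩ := exists_isClass_torIso P h1
  refine ⟨z, ⟨P, μ, a, b, ha, hb, ?_⟩, fun z' hz' => hz'.unique ⟨P, μ, a, b, ha, hb, ?_⟩⟩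
  all_goals exact (isClass_tensMul_iff μ a b _).mpr hz

/-- Elements of Tor which come from a module mapping to an ideal of square zero have product
zero. -/
theorem isTorProduct_zero {B' : Type u} [AddCommGroup B'] [Module R B'] (g : B' →ₗ[R] B)
    (hg : ∀ b b', g b * g b' = 0) {m n : ℕ} (x : TorM R A B' m) (y : TorM R A B' n) :
    IsTorProduct (TorMap A g m x : TorM R A B m) (TorMap A g n y : TorM R A B n) 0 := by
  let P := projectiveResolution (ModuleCat.of R B)
  let P' := projectiveResolution (ModuleCat.of R B')
  obtain ⟨μ⟩ := exists_resPairing P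
  obtain ⟨f, hf⟩ := exists_lift P'.projective P (P'.π.f 0 ≫ ModuleCat.ofHom g) (by
    refine ModuleCat.hom_ext (LinearMap.ext fun x => ?_)
    exact (congrArg g (aug_d P' x)).trans (map_zero g))
  obtain ⟨a, ha⟩ := exists_isClass_left ((torIso A P' m).hom.hom x)
  obtain ⟨b, hb⟩ := exists_isClass_left ((torIso A P' n).hom.hom y)
  obtain ⟨w, hw, -⟩ := isClass_cross (X := P'.complex) (Y := P'.complex) rfl ha ha hb hb
  refine ⟨P, μ, _, _, isClass_torIso_map g P' P f hf ha, isClass_torIso_map g P' P f hf hb, ?_⟩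
  have hf' : ∀ x, aug P ((f.f 0).hom x) = g (aug P' x) :=
    fun x => LinearMap.congr_fun (congrArg ModuleCat.Hom.hom hf) x
  -- The composite `P' ⊗ P' → P ⊗ P → P` covers `g(b) g(b') = 0`.
  obtain ⟨H⟩ := nonempty_homotopy_zero (projective_tot P'.projective P'.projective) P
    (totMap f f ≫ pairingMap μ) (by
      refine tot_hom_ext fun m n h x y => ?_
      obtain ⟨rfl, rfl⟩ : m = 0 ∧ n = 0 := by omega
      change aug P (((pairingMap μ).f 0).hom (((totMap f f).f 0).hom (tmulTot _ _ h x y))) = 0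
      rw [totMap_tmulTot, pairingMap_tmulTot]
      refine (μ.aug _ _).trans ?_
      exact (congrArg₂ (· * ·) (hf' x) (hf' y)).trans (hg _ _))
  obtain ⟨v, hv1, hv2⟩ := isClass_of_homotopy (A := A) H hw
  have hv : v = 0 := hv2.eq_zero_iff.mpr ⟨0, by
    rw [map_zero, HomologicalComplex.zero_f, Functor.map_zero]
    rfl⟩
  rw [hv, HomologicalComplex.comp_f, Functor.map_comp] at hv1
  rw [map_zero]
  refine (isClass_tensMul_iff μ _ _ _).mpr ?_
  have hc := cross_map f f (A := A) (rfl : m + n = m + n) a b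
  exact (congrArg (fun c => IsClass (tensC A P.complex) (m + n)
    (((tens R A).map ((pairingMap μ).f (m + n))).hom c) _) hc).mp hv1

end TorProduct

end

section

variable {R : Type u} [CommRing R] {ι : Type} [LinearOrder ι]

/-! ### The maps `∂_*` between Tor groups -/

theorem smul_eq_zero_of_mem_idl (u : ι → R) (i : ι) (a : R ⧸ idl u) : u i • a = 0 := by
  obtain ⟨r, rfl⟩ := Ideal.Quotient.mk_surjective a
  rw [← Ideal.Quotient.mk_eq_mk, ← Submodule.Quotient.mk_smul, Submodule.Quotient.mk_eq_zero]
  exact Ideal.mul_mem_right _ _ (Ideal.subset_span (Set.mem_range_self i))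

/-- Every term of the differential carries a factor `u_i`, which annihilates `R/I`. -/
theorem lTensor_dQ (u : ι → R) (p n : ℕ) : (dQ u p n).lTensor (R ⧸ idl u) = 0 := by
  refine TensorProduct.ext' fun a x => ?_
  rw [LinearMap.lTensor_tmul, LinearMap.zero_apply]
  refine LinearMap.congr_fun (f := TensorProduct.mk R (R ⧸ idl u) (Q R ι p n) a ∘ₗ dQ u p n)
    (g := 0) (Q_hom_ext fun S m hS _ => ?_) x
  rw [LinearMap.comp_apply, dQ_bas _ _ _ _ _ hS, map_sum, LinearMap.zero_apply]
  refine Finset.sum_eq_zero fun i _ => ?_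
  rw [mul_comm, mul_smul, map_smul, TensorProduct.mk_apply, TensorProduct.smul_tmul',
    smul_eq_zero_of_mem_idl, TensorProduct.zero_tmul]

theorem tensC_QComplex_d (u : ι → R) (p i j : ℕ) :
    (tensC (R ⧸ idl u) (QComplex u p)).d i j = 0 := by
  by_cases h : j + 1 = i
  · subst h
    refine ModuleCat.hom_ext ?_
    change ((QComplex u p).d (j + 1) j).hom.lTensor (R ⧸ idl u) = 0
    rw [QComplex_d]
    exact lTensor_dQ u p j
  · exact (tensC (R ⧸ idl u) (QComplex u p)).shape i j h

section Del

variable (M : Type u) [AddCommGroup M] [Module R M]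

theorem lTensor_del_del (p n : ℕ) (x : M ⊗[R] Q R ι p (n + 2)) :
    (del R ι (p + 1) n).lTensor M ((del R ι p (n + 1)).lTensor M x) = 0 := by
  rw [← LinearMap.comp_apply, ← LinearMap.lTensor_comp, del_del, LinearMap.lTensor_zero]
  rfl

theorem lTensor_delHtpy_del_zero (n : ℕ) (x : M ⊗[R] Q R ι 0 (n + 1)) :
    (delHtpy R ι 0 n).lTensor M ((del R ι 0 n).lTensor M x) = x := by
  rw [← LinearMap.comp_apply, ← LinearMap.lTensor_comp, delHtpy_del_zero, LinearMap.lTensor_id]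
  rfl

theorem lTensor_del_delHtpy_zero (p : ℕ) (x : M ⊗[R] Q R ι (p + 1) 0) :
    (del R ι p 0).lTensor M ((delHtpy R ι p 0).lTensor M x) = x := by
  rw [← LinearMap.comp_apply, ← LinearMap.lTensor_comp, del_delHtpy_zero, LinearMap.lTensor_id]
  rfl

/-- The homotopy identity is `R`-linear and passes to any tensor product, without flatness. -/
theorem lTensor_del_delHtpy (p n : ℕ) (x : M ⊗[R] Q R ι (p + 1) (n + 1))
    (hx : (del R ι (p + 1) n).lTensor M x = 0) :
    (del R ι p (n + 1)).lTensor M ((delHtpy R ι p (n + 1)).lTensor M x) = x := by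
  have h := congrArg (LinearMap.lTensor M) (del_delHtpy (R := R) (ι := ι) p n)
  rw [LinearMap.lTensor_add, LinearMap.lTensor_comp, LinearMap.lTensor_comp,
    LinearMap.lTensor_id] at h
  have h' := LinearMap.congr_fun h x
  rwa [LinearMap.add_apply, LinearMap.comp_apply, LinearMap.comp_apply, hx, map_zero,
    add_zero] at h'

end Del

section DelStar

variable (u : ι → R) (hQ : ∀ p, QuasiIso (QAug u p))

/-- The element `a` of `R/I ⊗ Q^(p)_n` represents the element `x` of Tor. -/
def Represents (p n : ℕ) (a : (R ⧸ idl u) ⊗[R] Q R ι p n) (x : TorM R (R ⧸ idl u) (Gr u p) n) :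
    Prop :=
  IsClass (tensC (R ⧸ idl u) (QComplex u p)) n a
    ((torIso (R ⧸ idl u) (QRes u p (hQ p)) n).hom.hom x)

variable {u hQ} {p n : ℕ}

theorem exists_represents_left (x : TorM R (R ⧸ idl u) (Gr u p) n) :
    ∃ a, Represents u hQ p n a x :=
  exists_isClass_left (C := tensC (R ⧸ idl u) (QComplex u p)) _

/-- All elements are cycles and no nonzero element bounds, so representatives always exist and, by
the next lemma, are unique. -/
theorem exists_represents_right (a : (R ⧸ idl u) ⊗[R] Q R ι p n) :
    ∃ x, Represents u hQ p n a x := by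
  obtain ⟨z, hz⟩ := exists_isClass_right (C := tensC (R ⧸ idl u) (QComplex u p)) (n := n) (a := a)
    (by rw [tensC_QComplex_d]; rfl)
  exact exists_isClass_torIso (QRes u p (hQ p)) hz

theorem Represents.eq_iff {a a' : (R ⧸ idl u) ⊗[R] Q R ι p n}
    {x x' : TorM R (R ⧸ idl u) (Gr u p) n} (h : Represents u hQ p n a x)
    (h' : Represents u hQ p n a' x') : x = x' ↔ a = a' := by
  rw [← (torIso_injective (QRes u p (hQ p)) n).eq_iff]
  refine (IsClass.eq_iff h h').trans ?_
  rw [tensC_QComplex_d]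
  refine ⟨fun ⟨w, hw⟩ => (sub_eq_zero.mp hw.symm), fun h => ⟨0, ?_⟩⟩
  exact (sub_eq_zero.mpr h).symm

theorem Represents.delStar {a : (R ⧸ idl u) ⊗[R] Q R ι p (n + 1)}
    {x : TorM R (R ⧸ idl u) (Gr u p) (n + 1)} (h : Represents u hQ p (n + 1) a x) :
    Represents u hQ (p + 1) n ((del R ι p n).lTensor _ a) (delStar u hQ p n x) := by
  have h1 := IsClass.degHom (C := tensC (R ⧸ idl u) (QComplex u p))
    (D := tensC (R ⧸ idl u) (QComplex u (p + 1)))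
    (f := fun n => (tens R (R ⧸ idl u)).map (delHom u p n))
    (tens_delHom_comm (R ⧸ idl u) u p) h
  have h2 := LinearMap.congr_fun (congrArg ModuleCat.Hom.hom
    (torIso (R ⧸ idl u) (QRes u (p + 1) (hQ (p + 1))) n).inv_hom_id)
  exact (congrArg (IsClass _ n _) (h2 _)).mpr h1

theorem represents_zero : Represents u hQ p n 0 0 := by
  have h := isClass_d (C := tensC (R ⧸ idl u) (QComplex u p)) (n := n) 0
  rw [map_zero] at h
  exact (congrArg (IsClass _ n 0) (map_zero _)).mpr h

theorem delStar_eq_iff {a : (R ⧸ idl u) ⊗[R] Q R ι p (n + 1)} {b : (R ⧸ idl u) ⊗[R] Q R ι (p + 1) n}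
    {x : TorM R (R ⧸ idl u) (Gr u p) (n + 1)} {y : TorM R (R ⧸ idl u) (Gr u (p + 1)) n}
    (hx : Represents u hQ p (n + 1) a x) (hy : Represents u hQ (p + 1) n b y) :
    delStar u hQ p n x = y ↔ (del R ι p n).lTensor _ a = b :=
  hx.delStar.eq_iff hy

theorem mem_range_delStar_iff {b : (R ⧸ idl u) ⊗[R] Q R ι (p + 1) n}
    {y : TorM R (R ⧸ idl u) (Gr u (p + 1)) n} (hy : Represents u hQ (p + 1) n b y) :
    (∃ x, delStar u hQ p n x = y) ↔ ∃ a, (del R ι p n).lTensor (R ⧸ idl u) a = b := by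
  constructor
  · rintro ⟨x, hx⟩
    obtain ⟨a, ha⟩ := exists_represents_left (hQ := hQ) x
    exact ⟨a, (delStar_eq_iff ha hy).mp hx⟩
  · rintro ⟨a, ha⟩
    obtain ⟨x, hx⟩ := exists_represents_right (hQ := hQ) a
    exact ⟨x, (delStar_eq_iff hx hy).mpr ha⟩

variable (u hQ)

theorem delStar_exact (p n : ℕ) :
    Function.Exact (delStar u hQ p (n + 1)) (delStar u hQ (p + 1) n) := by
  intro y
  obtain ⟨b, hb⟩ := exists_represents_left (hQ := hQ) y
  refine (delStar_eq_iff hb represents_zero).trans (Iff.trans ?_ (mem_range_delStar_iff hb).symm)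
  refine ⟨fun h => ⟨_, lTensor_del_delHtpy _ p n b h⟩, ?_⟩
  rintro ⟨a, rfl⟩
  exact lTensor_del_del _ p n a

theorem delStar_surjective (p : ℕ) : Function.Surjective (delStar u hQ p 0) := by
  intro y
  obtain ⟨b, hb⟩ := exists_represents_left (hQ := hQ) y
  exact (mem_range_delStar_iff hb).mpr ⟨_, lTensor_del_delHtpy_zero _ p b⟩

theorem delStar_injective (n : ℕ) : Function.Injective (delStar u hQ 0 n) := by
  intro x x' h
  obtain ⟨a, ha⟩ := exists_represents_left (hQ := hQ) x
  obtain ⟨a', ha'⟩ := exists_represents_left (hQ := hQ) x'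
  refine (ha.eq_iff ha').mpr ?_
  have h' := (ha.delStar.eq_iff ha'.delStar).mp h
  rw [← lTensor_delHtpy_del_zero _ n a, h', lTensor_delHtpy_del_zero]

end DelStar

/-! ### The complex `R/I ⊗ K(R; I^s)` -/

section TensorK

variable (u : ι → R) (s n : ℕ)

/-- The component of an element of `R/I ⊗ K(R; I^s)` in `R/I ⊗ Q^(k)`. -/
abbrev compT (k : ℕ) (hk : k < s) :
    (R ⧸ idl u) ⊗[R] K R ι s n →ₗ[R] (R ⧸ idl u) ⊗[R] Q R ι k n :=
  (comp R ι s n k hk).lTensor (R ⧸ idl u)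

/-- The inclusion of `R/I ⊗ Q^(k)` in `R/I ⊗ K(R; I^s)`. -/
abbrev inclT (k : ℕ) (hk : k < s) :
    (R ⧸ idl u) ⊗[R] Q R ι k n →ₗ[R] (R ⧸ idl u) ⊗[R] K R ι s n :=
  (inclK R ι s n ⟨k, hk⟩).lTensor (R ⧸ idl u)

/-- The differential of `R/I ⊗ K(R; I^s)`. -/
abbrev dT : (R ⧸ idl u) ⊗[R] K R ι s (n + 1) →ₗ[R] (R ⧸ idl u) ⊗[R] K R ι s n :=
  (dK u s n).lTensor (R ⧸ idl u)

variable {u s n}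

/-- The identity of the finite sum is the sum of projections followed by inclusions, and this
persists under tensoring. -/
theorem compT_ext {x y : (R ⧸ idl u) ⊗[R] K R ι s n}
    (h : ∀ k (hk : k < s), compT u s n k hk x = compT u s n k hk y) : x = y := by
  have hid : LinearMap.id = ∑ k : Fin s, inclT u s n k k.2 ∘ₗ compT u s n k k.2 := by
    refine TensorProduct.ext' fun a x => ?_
    rw [LinearMap.sum_apply]
    simp only [LinearMap.comp_apply, LinearMap.lTensor_tmul, LinearMap.id_apply]
    rw [← TensorProduct.tmul_sum]
    exact congrArg (fun x => a ⊗ₜ[R] x) (Finset.univ_sum_single x).symm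
  have hx := fun x => LinearMap.congr_fun hid x
  simp only [LinearMap.id_apply, LinearMap.sum_apply, LinearMap.comp_apply] at hx
  rw [hx x, hx y]
  exact Finset.sum_congr rfl fun k _ => by rw [h]

theorem compT_inclT_self (k : ℕ) (hk : k < s) (x : (R ⧸ idl u) ⊗[R] Q R ι k n) :
    compT u s n k hk (inclT u s n k hk x) = x := by
  rw [← LinearMap.comp_apply, ← LinearMap.lTensor_comp,
    show comp R ι s n k hk ∘ₗ inclK R ι s n ⟨k, hk⟩ = LinearMap.id from
      LinearMap.ext (comp_inclK_self s n k hk), LinearMap.lTensor_id]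
  rfl

theorem compT_inclT_of_ne {k j : ℕ} (hk : k < s) (hj : j < s) (h : j ≠ k)
    (x : (R ⧸ idl u) ⊗[R] Q R ι k n) : compT u s n j hj (inclT u s n k hk x) = 0 := by
  rw [← LinearMap.comp_apply, ← LinearMap.lTensor_comp,
    show comp R ι s n j hj ∘ₗ inclK R ι s n ⟨k, hk⟩ = 0 from
      LinearMap.ext (comp_inclK_of_ne s n hk hj h), LinearMap.lTensor_zero]
  rfl

theorem compT_zero_dT (hs : 0 < s) (x : (R ⧸ idl u) ⊗[R] K R ι s (n + 1)) :
    compT u s n 0 hs (dT u s n x) = 0 := by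
  rw [← LinearMap.comp_apply, ← LinearMap.lTensor_comp,
    show comp R ι s n 0 hs ∘ₗ dK u s n = dQ u 0 n ∘ₗ comp R ι s (n + 1) 0 hs from rfl,
    LinearMap.lTensor_comp, lTensor_dQ]
  rfl

/-- The column-preserving part of the differential dies modulo `I`, leaving a map that advances
columns by exactly one. -/
theorem compT_succ_dT {k : ℕ} (hk : k + 1 < s) (x : (R ⧸ idl u) ⊗[R] K R ι s (n + 1)) :
    compT u s n (k + 1) hk (dT u s n x) =
      (del R ι k n).lTensor (R ⧸ idl u) (compT u s (n + 1) k (Nat.lt_of_succ_lt hk) x) := by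
  rw [← LinearMap.comp_apply, ← LinearMap.lTensor_comp,
    show comp R ι s n (k + 1) hk ∘ₗ dK u s n =
      del R ι k n ∘ₗ comp R ι s (n + 1) k (Nat.lt_of_succ_lt hk) +
      dQ u (k + 1) n ∘ₗ comp R ι s (n + 1) (k + 1) hk from rfl,
    LinearMap.lTensor_add, LinearMap.lTensor_comp, LinearMap.lTensor_comp, lTensor_dQ,
    LinearMap.zero_comp, add_zero]
  rfl

theorem dT_inclT_last (t : ℕ) (x : (R ⧸ idl u) ⊗[R] Q R ι t (n + 1)) :
    dT u (t + 2) n (inclT u (t + 2) (n + 1) t (by omega) x) =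
      inclT u (t + 2) n (t + 1) (by omega) ((del R ι t n).lTensor _ x) := by
  refine compT_ext fun k hk => ?_
  cases k with
  | zero => rw [compT_zero_dT, compT_inclT_of_ne _ _ (by omega)]
  | succ k =>
    rw [compT_succ_dT]
    by_cases h : k = t
    · subst h
      rw [compT_inclT_self, compT_inclT_self]
    · rw [compT_inclT_of_ne _ _ h, compT_inclT_of_ne _ _ (by omega), map_zero]

theorem tensC_KComplex_d (u : ι → R) (s n : ℕ) :
    ((tensC (R ⧸ idl u) (KComplex u s)).d (n + 1) n).hom = dT u s n := by
  change ((KComplex u s).d (n + 1) n).hom.lTensor (R ⧸ idl u) = _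
  rw [KComplex_d]
  rfl

/-- Elements of `R/I ⊗ K(R; I^s)` with components `f_k`. -/
theorem exists_compT_eq (f : ∀ k, k < s → (R ⧸ idl u) ⊗[R] Q R ι k n) :
    ∃ x, ∀ k hk, compT u s n k hk x = f k hk := by
  refine ⟨∑ k : Fin s, inclT u s n k k.2 (f k k.2), fun k hk => ?_⟩
  rw [map_sum, Finset.sum_eq_single_of_mem ⟨k, hk⟩ (Finset.mem_univ _), compT_inclT_self]
  exact fun j _ hj => compT_inclT_of_ne _ _ (fun h => hj (Fin.ext h.symm)) _

end TensorK

/-! ### The spectral sequence -/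

section Collapse

theorem mem_bdry_of_eq {C : ChainComplex (ModuleCat.{u} R) ℕ} {F : ℤ → ∀ n, Submodule R (C.X n)}
    {r p : ℤ} {n : ℕ} {x y : C.X n} {w : C.X (n + 1)} (hy : y ∈ cyc C F (r - 1) (p + 1) n)
    (hw : w ∈ cyc C F (r - 1) (p - r + 1) (n + 1)) (h : y + (C.d (n + 1) n).hom w = x) :
    x ∈ bdry C F r p n :=
  Submodule.mem_sup.mpr ⟨y, hy, _, ⟨w, hw, rfl⟩, h⟩

variable {u : ι → R} {s n : ℕ}

theorem mem_colFil {p : ℤ} {x : (R ⧸ idl u) ⊗[R] K R ι s n} :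
    x ∈ colFil u s p n ↔ ∀ k (hk : k < s), (k : ℤ) < p → compT u s n k hk x = 0 := by
  change x ∈ (⨅ (k : Fin s) (_ : (k : ℤ) < p), LinearMap.ker (compT u s n k k.2)) ↔ _
  simp only [Submodule.mem_iInf, LinearMap.mem_ker]
  exact ⟨fun h k hk => h ⟨k, hk⟩, fun h k => h k k.2⟩

theorem mem_cyc_succ {r p : ℤ} {x : (R ⧸ idl u) ⊗[R] K R ι s (n + 1)} :
    x ∈ cyc (tensC (R ⧸ idl u) (KComplex u s)) (colFil u s) r p (n + 1) ↔
      x ∈ colFil u s p (n + 1) ∧ dT u s n x ∈ colFil u s (p + r) n := by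
  rw [← tensC_KComplex_d]
  rfl

theorem mem_cyc_zero {r p : ℤ} {x : (R ⧸ idl u) ⊗[R] K R ι s 0} :
    x ∈ cyc (tensC (R ⧸ idl u) (KComplex u s)) (colFil u s) r p 0 ↔ x ∈ colFil u s p 0 := by
  refine ⟨fun h => h.1, fun h => ⟨h, ?_⟩⟩
  change ((tensC (R ⧸ idl u) (KComplex u s)).d 0 0).hom x ∈ colFil u s (p + r) 0
  rw [(tensC (R ⧸ idl u) (KComplex u s)).shape 0 0 (by simp)]
  exact Submodule.zero_mem _

/-- The condition on `dx` involves only the sum of page and filtration index. -/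
theorem cyc_mono {r r' p : ℤ} (x : (R ⧸ idl u) ⊗[R] K R ι s n) (p' : ℤ)
    (hx : x ∈ cyc (tensC (R ⧸ idl u) (KComplex u s)) (colFil u s) r p n)
    (hx' : x ∈ colFil u s p' n) (h : p' + r' = p + r) :
    x ∈ cyc (tensC (R ⧸ idl u) (KComplex u s)) (colFil u s) r' p' n :=
  ⟨hx', by rw [h]; exact hx.2⟩

/-- Columns from `p + r` on of `dx` depend only on columns from `p + r - 1` on of `x`. Dropping the
others keeps `dx`, and what remains has filtration at least `p + 1` because `r ≥ 2`. -/
theorem dT_mem_bdry {r p : ℤ} (hr : 2 ≤ r) {x : (R ⧸ idl u) ⊗[R] K R ι s (n + 1)}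
    (hx : x ∈ cyc (tensC (R ⧸ idl u) (KComplex u s)) (colFil u s) r p (n + 1)) :
    dT u s n x ∈ bdry (tensC (R ⧸ idl u) (KComplex u s)) (colFil u s) r (p + r) n := by
  obtain ⟨-, hdx⟩ := mem_cyc_succ.mp hx
  obtain ⟨y, hy⟩ := exists_compT_eq (u := u) (s := s) (n := n + 1)
    fun k hk => if p + r - 1 ≤ k then compT u s (n + 1) k hk x else 0
  have hd : dT u s n y = dT u s n x := by
    refine compT_ext fun k hk => ?_
    cases k with
    | zero => rw [compT_zero_dT, compT_zero_dT]
    | succ k =>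
      by_cases h : p + r - 1 ≤ k
      · rw [compT_succ_dT, compT_succ_dT, hy, if_pos h]
      · rw [mem_colFil.mp hdx (k + 1) hk (by push_cast; omega), compT_succ_dT, hy, if_neg h,
          map_zero]
  refine mem_bdry_of_eq (w := y) (Submodule.zero_mem _) ?_ ?_
  · refine mem_cyc_succ.mpr ⟨mem_colFil.mpr fun k hk hkp => ?_, ?_⟩
    · rw [hy, if_neg (by omega)]
    · rw [hd, show p + r - r + 1 + (r - 1) = p + r by ring]
      exact hdx
  · rw [tensC_KComplex_d]
    exact (zero_add _).trans hd

theorem pageD_eq_zero (u : ι → R) (s : ℕ) {r : ℤ} (hr : 2 ≤ r) (p : ℤ) (n : ℕ) :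
    pageD (tensC (R ⧸ idl u) (KComplex u s)) (colFil u s) r p n = 0 := by
  refine Submodule.linearMap_qext _ (LinearMap.ext ?_)
  rintro ⟨x, hx⟩
  refine (Submodule.Quotient.mk_eq_zero _).mpr ?_
  change ((tensC (R ⧸ idl u) (KComplex u s)).d (n + 1) n).hom x ∈
    bdry (tensC (R ⧸ idl u) (KComplex u s)) (colFil u s) r (p + r) n
  rw [tensC_KComplex_d]
  exact dT_mem_bdry hr hx

/-- Before the last column, the leading component is killed by `∂` when `n > 0`. In column zero it
then vanishes; in later columns it is `∂y`, and subtracting the boundary of `y` raises the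
filtration. -/
theorem cyc_two_le_bdry {p : ℤ} (hp : p ≠ s - 1) (hpn : ¬ (p = 0 ∧ n = 0))
    {x : (R ⧸ idl u) ⊗[R] K R ι s n}
    (hx : x ∈ cyc (tensC (R ⧸ idl u) (KComplex u s)) (colFil u s) 2 p n) :
    x ∈ bdry (tensC (R ⧸ idl u) (KComplex u s)) (colFil u s) 2 p n := by
  have hxF : ∀ k (hk : k < s), (k : ℤ) < p → compT u s n k hk x = 0 := mem_colFil.mp hx.1
  by_cases hF : x ∈ colFil u s (p + 1) n
  · refine mem_bdry_of_eq (cyc_mono x (p + 1) hx hF (by ring)) (Submodule.zero_mem _) ?_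
    rw [map_zero]
    exact add_zero x
  obtain ⟨k, hk, rfl, hxk⟩ : ∃ (k : ℕ) (hk : k < s), p = k ∧ compT u s n k hk x ≠ 0 := by
    by_contra! h
    refine hF (mem_colFil.mpr fun k hk hkp => ?_)
    by_cases hkp' : (k : ℤ) < p
    · exact hxF k hk hkp'
    · exact h k hk (by omega)
  have hk1 : k + 1 < s := by omega
  have hdel : ∀ n' (x : (R ⧸ idl u) ⊗[R] K R ι s (n' + 1)),
      x ∈ cyc (tensC (R ⧸ idl u) (KComplex u s)) (colFil u s) 2 k (n' + 1) →
      (del R ι k n').lTensor _ (compT u s (n' + 1) k hk x) = 0 := fun n' x hx => by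
    rw [← compT_succ_dT hk1]
    exact mem_colFil.mp (mem_cyc_succ.mp hx).2 _ _ (by push_cast; omega)
  obtain ⟨j, rfl⟩ : ∃ j, k = j + 1 := by
    rcases k with _ | j
    · rcases n with _ | n
      · exact absurd ⟨rfl, rfl⟩ hpn
      · refine absurd ?_ hxk
        rw [← lTensor_delHtpy_del_zero _ n (compT u s (n + 1) 0 hk x), hdel n x hx, map_zero]
    · exact ⟨j, rfl⟩
  obtain ⟨y, hy⟩ : ∃ y, (del R ι j n).lTensor (R ⧸ idl u) y = compT u s n (j + 1) hk x := by
    rcases n with _ | n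
    · exact ⟨_, lTensor_del_delHtpy_zero _ j _⟩
    · exact ⟨_, lTensor_del_delHtpy _ j n _ (hdel n x hx)⟩
  have hj : j < s := by omega
  have hdy : ∀ k (hk : k < s), k < j + 1 →
      compT u s n k hk (dT u s n (inclT u s (n + 1) j hj y)) = 0 := fun k hk hkj => by
    rcases k with _ | k
    · rw [compT_zero_dT]
    · rw [compT_succ_dT, compT_inclT_of_ne _ _ (by omega), map_zero]
  -- The chain sits in column `p - 1`, which is `p - r + 1` for `r = 2`.
  have hyc : inclT u s (n + 1) j hj y ∈ cyc (tensC (R ⧸ idl u) (KComplex u s)) (colFil u s)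
      (2 - 1) (((j + 1 : ℕ) : ℤ) - 2 + 1) (n + 1) := by
    refine mem_cyc_succ.mpr ⟨mem_colFil.mpr fun k hk hkp => ?_, mem_colFil.mpr fun k hk hkp => ?_⟩
    · exact compT_inclT_of_ne _ _ (by omega) _
    · exact hdy k hk (by omega)
  have hz : x - dT u s n (inclT u s (n + 1) j hj y) ∈
      cyc (tensC (R ⧸ idl u) (KComplex u s)) (colFil u s) (2 - 1) ((j + 1 : ℕ) + 1) n := by
    have hzF : x - dT u s n (inclT u s (n + 1) j hj y) ∈ colFil u s ((j + 1 : ℕ) + 1) n := by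
      refine mem_colFil.mpr fun k hk hkp => ?_
      rw [map_sub]
      by_cases hkj : k = j + 1
      · subst hkj
        rw [compT_succ_dT, compT_inclT_self, hy, sub_self]
      · rw [hxF k hk (by omega), hdy k hk (by omega), sub_zero]
    rcases n with _ | n
    · exact mem_cyc_zero.mpr hzF
    · refine mem_cyc_succ.mpr ⟨hzF, ?_⟩
      rw [map_sub, show dT u s n (dT u s (n + 1) (inclT u s (n + 2) j hj y)) = 0 by
        rw [← LinearMap.comp_apply, ← LinearMap.lTensor_comp, dK_dK, LinearMap.lTensor_zero]
        rfl, sub_zero, show ((j + 1 : ℕ) : ℤ) + 1 + (2 - 1) = (j + 1 : ℕ) + 2 by ring]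
      exact (mem_cyc_succ.mp hx).2
  refine mem_bdry_of_eq hz hyc ?_
  rw [tensC_KComplex_d]
  exact sub_add_cancel x _

theorem subsingleton_page_two (u : ι → R) {s : ℕ} {p : ℤ} {n : ℕ} (hp : p ≠ s - 1)
    (hpn : ¬ (p = 0 ∧ n = 0)) :
    Subsingleton (page (tensC (R ⧸ idl u) (KComplex u s)) (colFil u s) 2 p n) := by
  refine Submodule.Quotient.subsingleton_iff.mpr (Submodule.submoduleOf_eq_top.mpr ?_)
  exact fun x hx => cyc_two_le_bdry hp hpn hx

end Collapse

end

section

variable {R : Type u} [CommRing R] {ι : Type} [LinearOrder ι]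

/-! ### The groups `Tor_n^R(R/I, R/I^s)` -/

/-- The complex `K(R; I^s)`, as a projective resolution of `R / I^s`. -/
def KRes (u : ι → R) (s : ℕ) (h : QuasiIso (KAug u s)) :
    ProjectiveResolution (ModuleCat.of R (R ⧸ idl u ^ s)) where
  complex := KComplex u s
  projective n := by
    have : Projective (ModuleCat.of R (K R ι s n)) := (IsProjective.iff_projective _).mp inferInstance
    exact this
  π := KAug u s
  quasiIso := h

section Incl

variable (u : ι → R) (t : ℕ)

theorem dK_inclK_last (n : ℕ) (x : Q R ι (t + 1) (n + 1)) :
    dK u (t + 2) n (inclK R ι (t + 2) (n + 1) ⟨t + 1, by omega⟩ x) =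
      inclK R ι (t + 2) n ⟨t + 1, by omega⟩ (dQ u (t + 1) n x) := by
  refine K_ext fun k hk => ?_
  rw [comp_dK]
  rcases Nat.lt_succ_iff_lt_or_eq.mp hk with h | rfl
  · rw [dKcomp_inclK_of_lt u _ hk h, comp_inclK_of_ne _ _ _ _ h.ne]
  · rw [dKcomp_inclK_self, comp_inclK_self]

/-- The inclusion of the last column of `K(R; I^s)`, with the sign which makes it compatible with
the augmentations. -/
def inclLast : QComplex u (t + 1) ⟶ KComplex u (t + 2) where
  f n := ModuleCat.ofHom ((-1 : R) ^ (t + 1) • inclK R ι (t + 2) n ⟨t + 1, by omega⟩)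
  comm' := by
    rintro _ n rfl
    rw [QComplex_d, KComplex_d]
    refine ModuleCat.hom_ext (LinearMap.ext fun x => ?_)
    exact (map_smul (dK u (t + 2) n) _ _).trans
      (congrArg (fun y => (-1 : R) ^ (t + 1) • y) (dK_inclK_last u t n x))

/-- The sign in the chain map cancels the augmentation sign of column `t + 1`, so the chain map lies
over the inclusion. -/
theorem augK_inclLast (x : Q R ι (t + 1) 0) :
    augK u (t + 2) ((-1 : R) ^ (t + 1) • inclK R ι (t + 2) 0 ⟨t + 1, by omega⟩ x) =
      grIncl u (t + 1) (augQ u (t + 1) x) := by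
  rw [augK_apply, Finset.sum_eq_single_of_mem ⟨t + 1, by omega⟩ (Finset.mem_univ _), map_smul,
    comp_inclK_self, map_smul, smul_eq_mul, ← mul_assoc, ← mul_pow, neg_one_mul, neg_neg, one_pow,
    one_mul, augQ_apply]
  · rfl
  · intro k _ hk
    rw [map_smul, comp_inclK_of_ne _ _ _ _ (fun h => hk (Fin.ext h)), smul_zero, map_zero, mul_zero]

variable {u t}

theorem Represents.isClass {hQ : ∀ p, QuasiIso (QAug u p)} (hK : QuasiIso (KAug u (t + 2)))
    {n : ℕ} {a : (R ⧸ idl u) ⊗[R] Q R ι (t + 1) n} {x : TorM R (R ⧸ idl u) (Gr u (t + 1)) n}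
    (h : Represents u hQ (t + 1) n a x) :
    IsClass (tensC (R ⧸ idl u) (KComplex u (t + 2))) n
      (inclT u (t + 2) n (t + 1) (by omega) ((-1 : R) ^ (t + 1) • a))
      ((torIso (R ⧸ idl u) (KRes u (t + 2) hK) n).hom.hom
        (TorMap (R ⧸ idl u) (grIncl u (t + 1)) n x)) := by
  have h1 := isClass_torIso_map (grIncl u (t + 1)) (QRes u (t + 1) (hQ (t + 1)))
    (KRes u (t + 2) hK) (inclLast u t)
    (ModuleCat.hom_ext (LinearMap.ext fun x => augK_inclLast u t x)) h
  have h2 : inclT u (t + 2) n (t + 1) (by omega) ((-1 : R) ^ (t + 1) • a) =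
      LinearMap.lTensor (R ⧸ idl u)
        ((-1 : R) ^ (t + 1) • inclK R ι (t + 2) n ⟨t + 1, by omega⟩) a := by
    rw [LinearMap.lTensor_smul, LinearMap.smul_apply, map_smul]
  exact (congrArg (fun b => IsClass (tensC (R ⧸ idl u) (KComplex u (t + 2))) n b _) h2).mpr h1

/-- For a cycle, `∂` kills every component before the last, so exactness lets a boundary remove all
of them. -/
theorem exists_eq_inclT_add_dT {n : ℕ} {x : (R ⧸ idl u) ⊗[R] K R ι (t + 2) (n + 1)}
    (hx : dT u (t + 2) n x = 0) :
    ∃ z w, x = inclT u (t + 2) (n + 1) (t + 1) (by omega) z + dT u (t + 2) (n + 1) w := by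
  have hdel : ∀ k (hk : k + 1 < t + 2),
      (del R ι k n).lTensor (R ⧸ idl u) (compT u (t + 2) (n + 1) k (by omega) x) = 0 :=
    fun k hk => by rw [← compT_succ_dT hk, hx, map_zero]
  -- Column `k` of `w` is the homotopy applied to `x_(k+1)`. The last column of `w` has zero
  -- differential, so its default value is immaterial.
  obtain ⟨w, hw⟩ := exists_compT_eq (u := u) (s := t + 2) (n := n + 2) fun k hk =>
    if h : k + 1 < t + 2 then
      (delHtpy R ι k (n + 1)).lTensor _ (compT u (t + 2) (n + 1) (k + 1) h x) else 0
  refine ⟨compT u (t + 2) (n + 1) (t + 1) (by omega) (x - dT u (t + 2) (n + 1) w), w,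
    eq_add_of_sub_eq (compT_ext fun k hk => ?_)⟩
  by_cases hkt : k = t + 1
  · subst hkt
    rw [compT_inclT_self]
  rw [compT_inclT_of_ne _ _ hkt, map_sub]
  cases k with
  | zero =>
    -- No boundary reaches column zero; positive degree is needed here, so that injectivity of `∂`
    -- makes this component vanish.
    rw [compT_zero_dT, sub_zero, ← lTensor_delHtpy_del_zero _ n (compT u (t + 2) (n + 1) 0 hk x),
      hdel 0 (by omega), map_zero]
  | succ k =>
    rw [compT_succ_dT, hw, dif_pos hk, lTensor_del_delHtpy _ _ _ _ (hdel (k + 1) (by omega)),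
      sub_self]

/-- The last column receives only `∂` from column `t`, and any element of that column may be used
alone. -/
theorem exists_dT_eq_inclT_iff {n : ℕ} (z : (R ⧸ idl u) ⊗[R] Q R ι (t + 1) n) :
    (∃ w, dT u (t + 2) n w = inclT u (t + 2) n (t + 1) (by omega) z) ↔
      ∃ a, (del R ι t n).lTensor (R ⧸ idl u) a = z := by
  constructor
  · rintro ⟨w, hw⟩
    refine ⟨compT u (t + 2) (n + 1) t (by omega) w, ?_⟩
    rw [← compT_succ_dT (Nat.lt_succ_self (t + 1)), hw, compT_inclT_self]
  · rintro ⟨a, rfl⟩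
    exact ⟨_, dT_inclT_last t a⟩

theorem smul_neg_one_pow_self {M : Type*} [AddCommMonoid M] [Module R M] (k : ℕ) (x : M) :
    (-1 : R) ^ k • (-1 : R) ^ k • x = x := by
  rw [smul_smul, ← mul_pow, neg_one_mul, neg_neg, one_pow, one_smul]

theorem torMap_grIncl_surjective (hQ : ∀ p, QuasiIso (QAug u p)) (hK : QuasiIso (KAug u (t + 2)))
    (n : ℕ) : Function.Surjective (TorMap (R ⧸ idl u) (grIncl u (t + 1)) (n + 1)) := by
  intro y
  obtain ⟨x, hx⟩ := exists_isClass_left (C := tensC (R ⧸ idl u) (KComplex u (t + 2)))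
    ((torIso (R ⧸ idl u) (KRes u (t + 2) hK) (n + 1)).hom.hom y)
  obtain ⟨z, w, hzw⟩ := exists_eq_inclT_add_dT (n := n) (x := x) (by
    rw [← tensC_KComplex_d]
    exact hx.d_eq_zero n)
  obtain ⟨y', hy'⟩ := exists_represents_right (hQ := hQ) ((-1 : R) ^ (t + 1) • z)
  refine ⟨y', torIso_injective (KRes u (t + 2) hK) (n + 1) ?_⟩
  refine ((hy'.isClass hK).eq_iff hx).mpr ⟨-w, ?_⟩
  rw [tensC_KComplex_d]
  refine (map_neg (dT u (t + 2) (n + 1)) w).trans (Eq.symm ?_)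
  rw [smul_neg_one_pow_self]
  exact (congrArg (fun v => _ - v) hzw).trans (sub_add_cancel_left _ _)

theorem torMap_grIncl_eq_zero_iff (hQ : ∀ p, QuasiIso (QAug u p))
    (hK : QuasiIso (KAug u (t + 2))) (n : ℕ) (x : TorM R (R ⧸ idl u) (Gr u (t + 1)) n) :
    TorMap (R ⧸ idl u) (grIncl u (t + 1)) n x = 0 ↔ ∃ y, delStar u hQ t n y = x := by
  obtain ⟨a, ha⟩ := exists_represents_left (hQ := hQ) x
  rw [mem_range_delStar_iff ha, ← map_eq_zero_iff _ (torIso_injective (KRes u (t + 2) hK) n)]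
  refine (ha.isClass hK).eq_zero_iff.trans ?_
  rw [tensC_KComplex_d]
  refine (exists_dT_eq_inclT_iff _).trans ⟨?_, ?_⟩
  · rintro ⟨b, hb⟩
    exact ⟨(-1 : R) ^ (t + 1) • b, by rw [map_smul, hb, smul_neg_one_pow_self]⟩
  · rintro ⟨b, rfl⟩
    exact ⟨(-1 : R) ^ (t + 1) • b, map_smul _ _ _⟩

theorem exists_coker_equiv (hQ : ∀ p, QuasiIso (QAug u p)) (hK : QuasiIso (KAug u (t + 2)))
    (n : ℕ) :
    ∃ e : (TorM R (R ⧸ idl u) (Gr u (t + 1)) (n + 1) ⧸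
        LinearMap.range (delStar u hQ t (n + 1)).hom) ≃ₗ[R]
        TorM R (R ⧸ idl u) (R ⧸ idl u ^ (t + 2)) (n + 1),
      ∀ x, e (Submodule.Quotient.mk x) = TorMap (R ⧸ idl u) (grIncl u (t + 1)) (n + 1) x := by
  have h : LinearMap.range (delStar u hQ t (n + 1)).hom =
      LinearMap.ker (TorMap (R ⧸ idl u) (grIncl u (t + 1)) (n + 1)).hom :=
    Submodule.ext fun x => (torMap_grIncl_eq_zero_iff hQ hK (n + 1) x).symm
  exact ⟨(Submodule.quotEquivOfEq _ _ h).trans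
    (LinearMap.quotKerEquivOfSurjective _ (torMap_grIncl_surjective hQ hK n)), fun x => rfl⟩

/-- Products of two elements of `I^(t+1)` lie in `I^(2t+2)`, which is contained in `I^(t+2)`. -/
theorem grIncl_mul_grIncl (u : ι → R) (t : ℕ) (x y : Gr u (t + 1)) :
    (grIncl u (t + 1) x * grIncl u (t + 1) y : R ⧸ idl u ^ (t + 2)) = 0 := by
  obtain ⟨⟨x, hx⟩, rfl⟩ := Submodule.Quotient.mk_surjective _ x
  obtain ⟨⟨y, hy⟩, rfl⟩ := Submodule.Quotient.mk_surjective _ y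
  change Ideal.Quotient.mk (idl u ^ (t + 2)) x * Ideal.Quotient.mk (idl u ^ (t + 2)) y = 0
  rw [← map_mul, Ideal.Quotient.eq_zero_iff_mem]
  refine Ideal.pow_le_pow_right (by omega : t + 2 ≤ (t + 1) + (t + 1)) ?_
  rw [pow_add]
  exact Ideal.mul_mem_mul hx hy

theorem isTorProduct_zero_of_pos (hQ : ∀ p, QuasiIso (QAug u p)) (hK : QuasiIso (KAug u (t + 2)))
    {m n : ℕ} (hm : 0 < m) (hn : 0 < n) (x : TorM R (R ⧸ idl u) (R ⧸ idl u ^ (t + 2)) m)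
    (y : TorM R (R ⧸ idl u) (R ⧸ idl u ^ (t + 2)) n) : IsTorProduct x y 0 := by
  obtain ⟨m, rfl⟩ := Nat.exists_eq_succ_of_ne_zero hm.ne'
  obtain ⟨n, rfl⟩ := Nat.exists_eq_succ_of_ne_zero hn.ne'
  obtain ⟨x, rfl⟩ := torMap_grIncl_surjective hQ hK m x
  obtain ⟨y, rfl⟩ := torMap_grIncl_surjective hQ hK n y
  exact isTorProduct_zero _ (grIncl_mul_grIncl u t) x y

end Incl

/-- `R/J` is cyclic on the class of `1`, so every tensor can be written `a ⊗ 1`, and `a ↦ a ⊗ 1` is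
the inverse. -/
theorem bijective_mul_lTensor_factor {I J : Ideal R} (h : J ≤ I) :
    Function.Bijective (LinearMap.mul' R (R ⧸ I) ∘ₗ
      LinearMap.lTensor (R ⧸ I) (Submodule.factor h)) := by
  refine Function.bijective_iff_has_inverse.mpr ⟨fun a => a ⊗ₜ[R] Ideal.Quotient.mk J 1, ?_, ?_⟩
  · intro x
    induction x with
    | zero => exact (congrArg (· ⊗ₜ[R] _) (map_zero _)).trans (TensorProduct.zero_tmul _ _)
    | add x y hx hy =>
      refine (congrArg (· ⊗ₜ[R] _) (map_add _ x y)).trans ((TensorProduct.add_tmul _ _ _).trans ?_)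
      exact congrArg₂ (· + ·) hx hy
    | tmul a b =>
      obtain ⟨r, rfl⟩ := Ideal.Quotient.mk_surjective b
      have h1 : Ideal.Quotient.mk J r = r • Ideal.Quotient.mk J 1 :=
        congrArg _ (mul_one r).symm
      have h2 : a * Ideal.Quotient.mk I r = r • a :=
        (mul_comm _ _).trans (Algebra.smul_def r a).symm
      refine (congrArg (· ⊗ₜ[R] Ideal.Quotient.mk J 1) h2).trans ?_
      rw [h1, TensorProduct.tmul_smul, TensorProduct.smul_tmul']
  · intro a
    exact mul_one a

theorem torZeroMap_bijective (u : ι → R) (s : ℕ) (hs : s ≠ 0) :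
    Function.Bijective (torZeroMap u s hs) := by
  have h : Function.Bijective
      ((tens R (R ⧸ idl u)).fromLeftDerivedZero.app (ModuleCat.of R (R ⧸ idl u ^ s))).hom :=
    (ConcreteCategory.isIso_iff_bijective _).mp inferInstance
  have h' := (bijective_mul_lTensor_factor (Ideal.pow_le_self (I := idl u) hs)).comp h
  exact h'

end

end RegularQuotient
end

/-! ### Assembly of the theorem -/

theorem mainTheorem4 {R : Type*} [CommRing R] {ι : Type} [LinearOrder ι] (u : ι → R)
    (hu : IsRegularSeq u) :
    -- the complexes `Q^(p)` resolve `I^p / I^(p+1)`, so that the maps `∂_*` on Tor make sense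
    ∃ hQ : ∀ p, QuasiIso (QAug u p),
      -- exactness at `Tor_n(R/I, I^(p+1)/I^(p+2))`, for `n ≥ 1` and for `n = 0`
      (∀ p n, Function.Exact (delStar u hQ p (n + 1)) (delStar u hQ (p + 1) n)) ∧
      (∀ p, Function.Surjective (delStar u hQ p 0)) ∧
      -- `∂^(1)_*` is injective in positive degrees
      (∀ n, Function.Injective (delStar u hQ 0 n)) ∧
      -- for every `s = t + 2 ≥ 2`:
      ∀ t : ℕ,
        -- the filtered complex `R/I ⊗ K(R; I^s)` computes `Tor_*(R/I, R/I^s)`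
        QuasiIso (KAug u (t + 2)) ∧
        -- its spectral sequence collapses at the second page, which is concentrated in column
        -- `s - 1` and in column `0`, total degree `0`
        (∀ (r : ℤ), 2 ≤ r → ∀ (p : ℤ) (n : ℕ),
          pageD (tensC (R ⧸ idl u) (KComplex u (t + 2))) (colFil u (t + 2)) r p n = 0) ∧
        (∀ (p : ℤ) (n : ℕ), p ≠ t + 1 → ¬ (p = 0 ∧ n = 0) →
          Subsingleton (page (tensC (R ⧸ idl u) (KComplex u (t + 2))) (colFil u (t + 2)) 2 p n)) ∧
        -- `Tor_0(R/I, R/I^s) = R/I`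
        Function.Bijective (torZeroMap u (t + 2) (Nat.succ_ne_zero (t + 1))) ∧
        -- `Tor_n(R/I, R/I^s) = coker ∂^(s-1)_*` for `n ≥ 1`
        (∀ n : ℕ, ∃ e : (TorM R (R ⧸ idl u) (Gr u (t + 1)) (n + 1) ⧸
              LinearMap.range (delStar u hQ t (n + 1)).hom) ≃ₗ[R]
              TorM R (R ⧸ idl u) (R ⧸ idl u ^ (t + 2)) (n + 1),
          ∀ x, e (Submodule.Quotient.mk x) =
            TorMap (R ⧸ idl u) (grIncl u (t + 1)) (n + 1) x) ∧
        -- the product of `Tor_*(R/I, R/I^s)` is well defined, and trivial in positive degrees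
        (∀ (m n : ℕ) (x : TorM R (R ⧸ idl u) (R ⧸ idl u ^ (t + 2)) m)
          (y : TorM R (R ⧸ idl u) (R ⧸ idl u ^ (t + 2)) n), ∃! z, IsTorProduct x y z) ∧
        (∀ (m n : ℕ), 0 < m → 0 < n →
          ∀ (x : TorM R (R ⧸ idl u) (R ⧸ idl u ^ (t + 2)) m)
            (y : TorM R (R ⧸ idl u) (R ⧸ idl u ^ (t + 2)) n), IsTorProduct x y 0) := by
  have hK : ∀ t, QuasiIso (KAug u (t + 2)) := fun t => quasiIso_KAug hu (Nat.succ_ne_zero (t + 1))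
  refine ⟨quasiIso_QAug hu, delStar_exact u _, delStar_surjective u _, delStar_injective u _,
    fun t => ⟨hK t, fun r hr p n => pageD_eq_zero u _ hr p n, fun p n hp hpn =>
      subsingleton_page_two u (by push_cast; omega) hpn, torZeroMap_bijective u _ _,
      exists_coker_equiv _ (hK t), fun m n => existsUnique_isTorProduct, fun m n hm hn =>
      isTorProduct_zero_of_pos (quasiIso_QAug hu) (hK t) hm hn⟩⟩
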